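/- Let $n\ge 3$, $1\le k\le n$, and let $\Omega\subset\mathbb R^n$ be a bounded domain with $C^\infty$ boundary. Write $d$ for the distance to $\partial\Omega$ and, for $x\in\Omega$ close to $\partial\Omega$, write $x'$ for the nearest point of $\partial\Omega$. For a $C^2$ function $u$ put $$A(u)=(n-2)\nabla^2u+\Delta u\,I+(n-2)\big(|\nabla u|^2I-\nabla u\otimes\nabla u\big),\qquad \widetilde F(u)=d^{2k}\Big(\sigma_k(A(u))-(n-1)^k\tbinom nk e^{2ku}\Big),$$ where $\sigma_k$ is the $k$-th elementary symmetric polynomial of the eigenvalues. Let $\Pi$ be the second fundamental form of $\partial\Omega$ with respect to the interior unit normal, $g$ the induced metric, $H=\kappa_1+\cdots+\kappa_{n-1}$ the trace of $\Pi$ (the sum of the principal curvatures), and $\overset{\circ}{\Pi}=\Pi-\frac1{n-1}Hg$ the trace-free second fundamental form. For smooth functions $c_0,\dots,c_{n-1},c_{n,1}$ on $\partial\Omega$ set, near $\partial\Omega$, $$v(x)=-\log d+c_0(x')+c_1(x')d+\cdots+c_{n-1}(x')d^{n-1}+c_{n,1}(x')d^n\log d .$$ Then the coefficients of $1,d,d^2$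 in $\widetilde F(v)$ vanish, i.e. $\widetilde F(v)=o(d^2)$ uniformly as $d\to0$, if and only if on $\partial\Omega$ $$c_0=0,\qquad c_1=\frac{1}{2(n-1)}H,$$ $$c_2=\frac{n}{6(n-2)}\left\{\Big(\frac{-3n+2}{4n(n-1)^2}-\frac{n^3-3n-n^2+4}{2n(n-1)^4}\Big)H^2+\Big(\frac2n+\frac{(n-2)^2}{2n(n-1)^3}\Big)|\Pi|^2\right\}+k\Big(-\frac{n-2}{12(n-1)^3}\Big)\big|\overset{\circ}{\Pi}\big|^2 .$$ In particular, whenever $v$ is a formal solution, in the sense that $\widetilde F(v)=O(d^{n+\tau})$ as $d\to0$ for some $\tau\in(0,1)$, its coefficient $c_2$ is given by this formula. -/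

import Mathlib

open scoped ContDiff Topology

namespace SigmaKRicci

noncomputable section

/-- Euclidean space `ℝⁿ`. -/
abbrev E (n : ℕ) : Type := EuclideanSpace ℝ (Fin n)

/-! ### Bounded smooth domains -/

/-- `φ` is a smooth defining function of `Ω` near the point `p`: near `p` the set `Ω` is
`{φ > 0}`, and `dφ(p) ≠ 0`. (If `p ∈ ∂Ω`, this forces `φ p = 0`, and `∂Ω` is `{φ = 0}` near `p`.) -/
structure IsDefiningFunctionAt {n : ℕ} (Ω : Set (E n)) (p : E n) (φ : E n → ℝ) : Prop where
  smooth : ContDiff ℝ ∞ φ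
  mem_iff : ∀ᶠ x in 𝓝 p, (x ∈ Ω ↔ 0 < φ x)
  fderiv_ne_zero : fderiv ℝ φ p ≠ 0

/-- A bounded domain (nonempty, open, connected) with `C^∞` boundary. -/
structure IsBoundedSmoothDomain {n : ℕ} (Ω : Set (E n)) : Prop where
  isOpen : IsOpen Ω
  isConnected : IsConnected Ω
  isBounded : Bornology.IsBounded Ω
  smooth_boundary : ∀ p ∈ frontier Ω, ∃ φ : E n → ℝ, IsDefiningFunctionAt Ω p φ

/-! ### Extrinsic geometry of the boundary -/

/-- A local defining function of `Ω` near `p`. Nothing below depends on which one is chosen. -/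
def definingFunction {n : ℕ} (Ω : Set (E n)) (p : E n) : E n → ℝ :=
  Classical.epsilon fun φ => IsDefiningFunctionAt Ω p φ

/-- The unit vector field `∇φ / |∇φ|`. If `φ` is a defining function of `Ω` near `p`, its values
on `∂Ω` near `p` are the interior unit normal vectors. -/
def unitGradient {n : ℕ} (φ : E n → ℝ) (x : E n) : E n :=
  ‖gradient φ x‖⁻¹ • gradient φ x

/-- The interior unit normal vector of `∂Ω` at `p`. -/
def innerNormal {n : ℕ} (Ω : Set (E n)) (p : E n) : E n :=
  unitGradient (definingFunction Ω p) p

/-- The tangent space `T_p ∂Ω`, as a linear subspace of `ℝⁿ`. -/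
abbrev tangentPlane {n : ℕ} (Ω : Set (E n)) (p : E n) : Submodule ℝ (E n) :=
  (Submodule.span ℝ {innerNormal Ω p})ᗮ

/-- The second fundamental form of `∂Ω` at `p` with respect to the interior unit normal `ν`:
`Π(X, Y) = -⟨D_X ν, Y⟩` for `X, Y ∈ T_p ∂Ω`. It is positive on spheres (for `Ω` a ball), and its
eigenvalues with respect to the induced metric are the principal curvatures. -/
def secondFundamentalForm {n : ℕ} (Ω : Set (E n)) (p : E n) :
    LinearMap.BilinForm ℝ (tangentPlane Ω p) :=
  LinearMap.BilinForm.restrict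
    (-((innerₗ (E n)).comp
      (fderiv ℝ (unitGradient (definingFunction Ω p)) p : E n →ₗ[ℝ] E n)))
    (tangentPlane Ω p)

/-- The trace of a bilinear form with respect to the inner product. -/
def formTrace {V : Type*} [NormedAddCommGroup V] [InnerProductSpace ℝ V] [FiniteDimensional ℝ V]
    (B : LinearMap.BilinForm ℝ V) : ℝ :=
  ∑ a, B (stdOrthonormalBasis ℝ V a) (stdOrthonormalBasis ℝ V a)

/-- The squared norm `|B|²` of a bilinear form with respect to the inner product. -/
def formNormSq {V : Type*} [NormedAddCommGroup V] [InnerProductSpace ℝ V] [FiniteDimensional ℝ V]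
    (B : LinearMap.BilinForm ℝ V) : ℝ :=
  ∑ a, ∑ b, B (stdOrthonormalBasis ℝ V a) (stdOrthonormalBasis ℝ V b) ^ 2

/-- The mean curvature `H = κ₁ + ⋯ + κ_{n-1}`, i.e. the trace of the second fundamental form. -/
def meanCurvature {n : ℕ} (Ω : Set (E n)) (p : E n) : ℝ :=
  formTrace (secondFundamentalForm Ω p)

/-- The trace-free second fundamental form `Π - H / (n - 1) g` of the `(n-1)`-dimensional
hypersurface `∂Ω`, where `g` is the induced metric. -/
def traceFreeSecondFundamentalForm {n : ℕ} (Ω : Set (E n)) (p : E n) :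
    LinearMap.BilinForm ℝ (tangentPlane Ω p) :=
  secondFundamentalForm Ω p - (meanCurvature Ω p / ((n : ℝ) - 1)) • innerₗ (tangentPlane Ω p)

/-! ### The operator -/

/-- The partial derivative `∂ᵢ u`. -/
def partialDeriv {n : ℕ} (i : Fin n) (u : E n → ℝ) (x : E n) : ℝ :=
  fderiv ℝ u x (EuclideanSpace.single i 1)

/-- The matrix
`A(u) = (n-2) ∇²u + Δu I + (n-2) (|∇u|² I - ∇u ⊗ ∇u)`. -/
def matrixA {n : ℕ} (u : E n → ℝ) (x : E n) : Matrix (Fin n) (Fin n) ℝ :=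
  ((n : ℝ) - 2) • Matrix.of (fun i j => partialDeriv i (partialDeriv j u) x)
    + (∑ l, partialDeriv l (partialDeriv l u) x) • (1 : Matrix (Fin n) (Fin n) ℝ)
    + ((n : ℝ) - 2) • ((∑ l, partialDeriv l u x ^ 2) • (1 : Matrix (Fin n) (Fin n) ℝ)
        - Matrix.of (fun i j => partialDeriv i u x * partialDeriv j u x))

/-- The `k`-th elementary symmetric polynomial of the eigenvalues (listed with multiplicity) of a
real symmetric matrix. -/
def sigma {n : ℕ} (k : ℕ) (M : Matrix (Fin n) (Fin n) ℝ) : ℝ :=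
  M.charpoly.roots.esymm k

/-- `F(u) = σ_k(A(u)) - (n-1)^k C(n,k) e^{2ku}`. -/
def opF {n : ℕ} (k : ℕ) (u : E n → ℝ) (x : E n) : ℝ :=
  sigma k (matrixA u x) - ((n : ℝ) - 1) ^ k * (n.choose k : ℝ) * Real.exp (2 * (k : ℝ) * u x)

/-- The distance `d` to `∂Ω`. -/
def bdist {n : ℕ} (Ω : Set (E n)) (x : E n) : ℝ :=
  Metric.infDist x (frontier Ω)

/-- `F̃(u) = F(u) d^{2k}`. -/
def opFtilde {n : ℕ} (Ω : Set (E n)) (k : ℕ) (u : E n → ℝ) (x : E n) : ℝ :=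
  opF k u x * bdist Ω x ^ (2 * k)

/-! ### Formal solutions -/

/-- The foot point `x' ∈ ∂Ω` of `x`: a point of `∂Ω` nearest to `x`. It is unique for `x` close
to `∂Ω`, where `(x', d)` are the coordinates adapted to the boundary. -/
def footPoint {n : ℕ} (Ω : Set (E n)) (x : E n) : E n :=
  Classical.epsilon fun y => y ∈ frontier Ω ∧ dist x y = Metric.infDist x (frontier Ω)

/-- The function
`v = -log d + c₀ + c₁ d + ⋯ + c_{n-1} d^{n-1} + c_{n,1} d^n log d`,
whose coefficients are functions of the foot point `x' ∈ ∂Ω` (only their values on `∂Ω` are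
used). -/
def ansatz {n : ℕ} (Ω : Set (E n)) (c : ℕ → E n → ℝ) (cn1 : E n → ℝ) (x : E n) : ℝ :=
  -Real.log (bdist Ω x)
    + ∑ i ∈ Finset.range n, c i (footPoint Ω x) * bdist Ω x ^ i
    + cn1 (footPoint Ω x) * bdist Ω x ^ n * Real.log (bdist Ω x)

/-- The coefficients `c₀, …, c_{n-1}` and `c_{n,1}` are smooth functions on `∂Ω`. -/
def SmoothCoefficients {n : ℕ} (Ω : Set (E n)) (c : ℕ → E n → ℝ) (cn1 : E n → ℝ) : Prop :=
  (∀ i < n, ContDiffOn ℝ ∞ (c i) (frontier Ω)) ∧ ContDiffOn ℝ ∞ cn1 (frontier Ω)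

/-- The filter of approach to the boundary: `x ∈ Ω` and `d(x) → 0`, uniformly along `∂Ω`. -/
def nearBoundary {n : ℕ} (Ω : Set (E n)) : Filter (E n) :=
  Filter.comap (bdist Ω) (𝓝 0) ⊓ Filter.principal Ω

/-- The closed expression for the second coefficient. -/
def c2Formula {n : ℕ} (Ω : Set (E n)) (k : ℕ) (y : E n) : ℝ :=
  (n : ℝ) / (6 * ((n : ℝ) - 2)) *
      (((-3 * (n : ℝ) + 2) / (4 * (n : ℝ) * ((n : ℝ) - 1) ^ 2)
          - ((n : ℝ) ^ 3 - 3 * (n : ℝ) - (n : ℝ) ^ 2 + 4) / (2 * (n : ℝ) * ((n : ℝ) - 1) ^ 4))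
          * meanCurvature Ω y ^ 2
        + (2 / (n : ℝ) + ((n : ℝ) - 2) ^ 2 / (2 * (n : ℝ) * ((n : ℝ) - 1) ^ 3))
          * formNormSq (secondFundamentalForm Ω y))
    + (k : ℝ) * (-(((n : ℝ) - 2) / (12 * ((n : ℝ) - 1) ^ 3)))
        * formNormSq (traceFreeSecondFundamentalForm Ω y)

end

end SigmaKRicci

/-!
The coefficients of `1`, `d`, `d²` in `F̃(v)` are read off from the limits of `F̃(v)`, `F̃(v) / d`
and `F̃(v) / d²` at the points of `∂Ω`, each limit being needed only once the previous coefficients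
vanish on all of `∂Ω`.

Near `p ∈ ∂Ω` the inverse function theorem, applied to `(q, t) ↦ (q + t ν(q), φ(q))`, gives normal
coordinates: smooth functions `y` and `ρ` which inside `Ω` are the foot point and the distance to
the boundary (`exists_isNormalCoordinates`). They satisfy `|∇ρ| = 1`, and `-∇²ρ(p)` is the second
fundamental form on the tangent space and zero on the normal; in particular `Δρ = -H` and
`|∇²ρ|² = |Π|²` on `∂Ω`. Write `v = -log ρ + w`, where `w` is `C₀ + C₁ ρ + C₂ ρ²`, `Cᵢ = cᵢ ∘ y`, up
to a remainder that is `o(ρ²)` in the `C²` sense (`exists_ansatz_eq`). The singular terms combine to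
`ρ² A(v) = (n - 1) I + ρ Y`, with `Y` bounded and explicit (`sq_smul_matrixA`), so that
`F̃(v) = σ_k((n - 1) I + ρ Y) - (n - 1)^k C(n, k) e^{2kw}`.

For symmetric matrices `σ_k` is the sum of the principal `k × k` minors, a coefficient of the
characteristic polynomial, and a Taylor shift of that polynomial gives
`σ_k(m I + ρ Y) = C(n, k) m^k + C(n-1, k-1) m^{k-1} ρ tr Y + C(n-2, k-2) m^{k-2} ρ² σ₂(Y) + o(ρ²)`
with `σ₂(Y) = ((tr Y)² - tr Y²) / 2` (`tendsto_sigma_smul_one_add`).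
* The zeroth limit is `C(n, k) (n - 1)^k (1 - e^{2k c₀})`.
* If `c₀ = 0`, the first limit is a positive multiple of `H - 2 (n - 1) c₁`.
* If in addition `c₁ = H / (2 (n - 1))`, the second limit needs `tr Y` to first order
  in `ρ`. The geometric input is the derivative of `Δρ` along the normal, which by the Riccati
  equation `∂_ν Δρ = -|∇²ρ|²` (differentiate `|∇ρ|² = 1` twice) equals `-|Π|²`. The result is
  `c2Formula - c₂` times a factor that is positive because `n ≥ 3`.

Since `∂Ω` is compact, the pointwise limits are equivalent to the uniform statement `F̃(v) = o(d²)`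
(`isLittleO_nearBoundary_iff`).
-/

namespace SigmaKRicci

open Filter

/-! ### Elementary symmetric functions of a symmetric matrix -/

/-- The sum of the principal `k × k` minors of a matrix. It is a polynomial in the entries, and it
is the `k`-th elementary symmetric polynomial of the eigenvalues if the matrix is symmetric. -/
def sumMinors {n : ℕ} (k : ℕ) (M : Matrix (Fin n) (Fin n) ℝ) : ℝ :=
  ∑ s ∈ Finset.univ.powersetCard k,
    (M.submatrix (Subtype.val : {i // i ∈ s} → Fin n) (Subtype.val : {i // i ∈ s} → Fin n)).det

theorem coeff_charpoly_eq_sumMinors {n k : ℕ} (hk : k ≤ n) (M : Matrix (Fin n) (Fin n) ℝ) :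
    M.charpoly.coeff (n - k) = (-1) ^ k * sumMinors k M := by
  simpa [sumMinors] using M.charpoly_coeff_eq_sum_minors k (by simpa using hk)

theorem sumMinors_eq_coeff {n k : ℕ} (hk : k ≤ n) (M : Matrix (Fin n) (Fin n) ℝ) :
    sumMinors k M = (-1) ^ k * M.charpoly.coeff (n - k) := by
  rw [coeff_charpoly_eq_sumMinors hk, ← mul_assoc, ← mul_pow]
  simp

theorem sigma_eq_sumMinors {n k : ℕ} (hk : k ≤ n) {M : Matrix (Fin n) (Fin n) ℝ}
    (hM : M.IsSymm) : sigma k M = sumMinors k M := by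
  have hH : M.IsHermitian := by
    rw [Matrix.IsHermitian, Matrix.conjTranspose_eq_transpose_of_trivial]
    exact hM
  have h := Polynomial.coeff_eq_esymm_roots_of_splits hH.splits_charpoly
    (k := n - k) (by simp)
  have e : n - (n - k) = k := by omega
  simp only [Matrix.charpoly_natDegree_eq_dim, Fintype.card_fin, e] at h
  rw [sumMinors_eq_coeff hk, h, (Matrix.charpoly_monic M).leadingCoeff, one_mul, ← mul_assoc,
    ← mul_pow]
  simp [sigma]

theorem continuous_sumMinors {n : ℕ} (k : ℕ) :
    Continuous (sumMinors k : Matrix (Fin n) (Fin n) ℝ → ℝ) := by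
  unfold sumMinors
  fun_prop

theorem sumMinors_smul {n : ℕ} (k : ℕ) (t : ℝ) (M : Matrix (Fin n) (Fin n) ℝ) :
    sumMinors k (t • M) = t ^ k * sumMinors k M := by
  unfold sumMinors
  rw [Finset.mul_sum]
  refine Finset.sum_congr rfl fun s hs => ?_
  rw [Matrix.submatrix_smul]
  simp [(Finset.mem_powersetCard.mp hs).2]

theorem sumMinors_zero {n : ℕ} (M : Matrix (Fin n) (Fin n) ℝ) : sumMinors 0 M = 1 := by
  simp [sumMinors]

theorem sumMinors_one {n : ℕ} (hn : 1 ≤ n) (M : Matrix (Fin n) (Fin n) ℝ) :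
    sumMinors 1 M = M.trace := by
  have : Nonempty (Fin n) := ⟨⟨0, hn⟩⟩
  rw [sumMinors_eq_coeff hn, Matrix.trace_eq_neg_charpoly_coeff]
  simp

theorem sumMinors_two {n : ℕ} (hn : 2 ≤ n) {M : Matrix (Fin n) (Fin n) ℝ} (hM : M.IsSymm) :
    sumMinors 2 M = (M.trace ^ 2 - (M * M).trace) / 2 := by
  have hH : M.IsHermitian := by
    rw [Matrix.IsHermitian, Matrix.conjTranspose_eq_transpose_of_trivial]
    exact hM
  have h1 : M.trace = ∑ i, hH.eigenvalues i := by
    simpa using hH.trace_eq_sum_eigenvalues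
  have h2 : (M * M).trace = ∑ i, hH.eigenvalues i ^ 2 := by
    conv_lhs => rw [hH.spectral_theorem]
    rw [← map_mul, Unitary.conjStarAlgAut_apply, Matrix.trace_mul_comm, ← mul_assoc]
    simp [Matrix.diagonal_mul_diagonal, Matrix.trace_diagonal, pow_two]
  have h3 : sumMinors 2 M = MvPolynomial.aeval hH.eigenvalues (MvPolynomial.esymm (Fin n) ℝ 2) := by
    rw [← sigma_eq_sumMinors hn hM, sigma, hH.roots_charpoly_eq_eigenvalues,
      MvPolynomial.aeval_esymm_eq_multiset_esymm]
    rfl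
  -- Newton's identity for the eigenvalues
  have h4 := congrArg (MvPolynomial.aeval hH.eigenvalues)
    (MvPolynomial.mul_esymm_eq_sum (Fin n) ℝ 2)
  have hs : (Finset.HasAntidiagonal.antidiagonal 2).filter (fun a : ℕ × ℕ => a.1 < 2)
      = ({(0, 2), (1, 1)} : Finset (ℕ × ℕ)) := by decide
  rw [hs] at h4
  simp [MvPolynomial.psum, MvPolynomial.esymm_one, MvPolynomial.esymm_zero] at h4
  rw [h3, h1, h2]
  simp at h4 ⊢
  linarith

/-- The values at `tI + X` in terms of the values at `X`: the characteristic polynomial of `tI + X`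
is a Taylor shift of that of `X`. -/
theorem sumMinors_smul_one_add {n k : ℕ} (hk : k ≤ n) (t : ℝ) (M : Matrix (Fin n) (Fin n) ℝ) :
    sumMinors k (t • (1 : Matrix (Fin n) (Fin n) ℝ) + M)
      = ∑ j ∈ Finset.range (n + 1), ((n - j).choose (n - k) : ℝ) * t ^ (k - j) * sumMinors j M := by
  have h := Matrix.charpoly_sub_scalar M (-t)
  have e : M - Matrix.scalar (Fin n) (-t) = t • (1 : Matrix (Fin n) (Fin n) ℝ) + M := by
    ext i j
    by_cases hij : i = j
    · subst hij
      simp [add_comm]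
    · simp [hij]
  rw [e, ← Polynomial.taylor_apply] at h
  have hd : M.charpoly.natDegree < n + 1 := by simp
  rw [sumMinors_eq_coeff hk, h, Polynomial.taylor_coeff, Polynomial.hasseDeriv_apply,
    Polynomial.sum_over_range' _ (by simp) (n + 1) hd, Polynomial.eval_finsetSum,
    ← Finset.sum_range_reflect, Finset.mul_sum]
  refine Finset.sum_congr rfl fun j hj => ?_
  have hj' : j ≤ n := by simpa [Nat.lt_succ_iff] using hj
  have e1 : n + 1 - 1 - j = n - j := by omega
  rw [e1, Polynomial.eval_monomial, coeff_charpoly_eq_sumMinors hj']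
  rcases le_or_gt j k with hjk | hjk
  · have e2 : n - j - (n - k) = k - j := by omega
    rw [e2]
    have e3 : ((-1 : ℝ)) ^ k * ((-1) ^ j * (-1) ^ (k - j)) = 1 := by
      rw [← pow_add, ← pow_add, show k + (j + (k - j)) = 2 * k by omega]
      simp
    rw [neg_pow t]
    linear_combination ((n - j).choose (n - k) : ℝ) * sumMinors j M * t ^ (k - j) * e3
  · rw [Nat.choose_eq_zero_of_lt (by omega)]
    simp

/-- Second order expansion of `σ_k (tI + dY)` as `d → 0` and `Y → Y₀`. -/
theorem tendsto_sigma_smul_one_add {α : Type*} {l : Filter α} {n k : ℕ} (hn : 2 ≤ n) (hk : k ≤ n)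
    (t : ℝ) {d : α → ℝ} {Y : α → Matrix (Fin n) (Fin n) ℝ} {Y₀ : Matrix (Fin n) (Fin n) ℝ}
    (hd : Tendsto d l (𝓝 0)) (hd0 : ∀ᶠ x in l, d x ≠ 0) (hY : Tendsto Y l (𝓝 Y₀))
    (hs : ∀ᶠ x in l, (Y x).IsSymm) (hs₀ : Y₀.IsSymm) :
    Tendsto (fun x => (sigma k (t • (1 : Matrix (Fin n) (Fin n) ℝ) + d x • Y x)
        - (n.choose k : ℝ) * t ^ k
        - ((n - 1).choose (n - k) : ℝ) * t ^ (k - 1) * d x * (Y x).trace) / d x ^ 2) l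
      (𝓝 (((n - 2).choose (n - k) : ℝ) * t ^ (k - 2)
        * ((Y₀.trace ^ 2 - (Y₀ * Y₀).trace) / 2))) := by
  -- the terms of order at least two, divided by `d²`
  have hlim : Tendsto (fun x => ∑ j ∈ Finset.range (n - 1),
      ((n - (j + 2)).choose (n - k) : ℝ) * t ^ (k - (j + 2)) * d x ^ j * sumMinors (j + 2) (Y x)) l
      (𝓝 (∑ j ∈ Finset.range (n - 1), ((n - (j + 2)).choose (n - k) : ℝ) * t ^ (k - (j + 2))
        * 0 ^ j * sumMinors (j + 2) Y₀)) := by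
    refine tendsto_finsetSum _ fun j _ => ?_
    exact (tendsto_const_nhds.mul (hd.pow j)).mul (((continuous_sumMinors _).tendsto _).comp hY)
  have e0 : (∑ j ∈ Finset.range (n - 1), ((n - (j + 2)).choose (n - k) : ℝ) * t ^ (k - (j + 2))
        * 0 ^ j * sumMinors (j + 2) Y₀) = ((n - 2).choose (n - k) : ℝ) * t ^ (k - 2)
        * ((Y₀.trace ^ 2 - (Y₀ * Y₀).trace) / 2) := by
    rw [Finset.sum_eq_single_of_mem 0 (by simp; omega)]
    · simp [sumMinors_two hn hs₀]
    · intro j _ hj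
      simp [hj]
  rw [e0] at hlim
  refine hlim.congr' ?_
  filter_upwards [hd0, hs] with x hx hsx
  have hsym : (t • (1 : Matrix (Fin n) (Fin n) ℝ) + d x • Y x).IsSymm :=
    (Matrix.isSymm_one.smul t).add (hsx.smul _)
  rw [sigma_eq_sumMinors hk hsym, sumMinors_smul_one_add hk]
  have en : n + 1 = (n - 1) + 1 + 1 := by omega
  rw [en, Finset.sum_range_succ', Finset.sum_range_succ', eq_div_iff (pow_ne_zero 2 hx),
    Finset.sum_mul]
  have hc : (n.choose (n - k) : ℝ) = n.choose k := by rw [Nat.choose_symm hk]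
  simp only [sumMinors_smul, sumMinors_zero, zero_add, sumMinors_one (by omega : 1 ≤ n)]
  simp only [Nat.sub_zero, hc]
  have : ∀ j ∈ Finset.range (n - 1), ((n - (j + 2)).choose (n - k) : ℝ) * t ^ (k - (j + 2)) *
      d x ^ j * sumMinors (j + 2) (Y x) * d x ^ 2 = ((n - (j + 1 + 1)).choose (n - k) : ℝ) *
        t ^ (k - (j + 1 + 1)) * (d x ^ (j + 1 + 1) * sumMinors (j + 1 + 1) (Y x)) := by
    intro j _
    ring
  rw [Finset.sum_congr rfl this, Matrix.trace_smul, smul_eq_mul]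
  simp only [mul_assoc]
  ring

/-! ### Normal coordinates at the boundary -/

section Boundary

variable {n : ℕ} {Ω : Set (E n)} {p : E n} {φ : E n → ℝ}

theorem gradient_apply (f : E n → ℝ) (x : E n) (i : Fin n) :
    gradient f x i = partialDeriv i f x := by
  rw [partialDeriv, ← inner_gradient_left]
  rw [EuclideanSpace.inner_single_right]
  simp

theorem eq_gradient_of_inner {f : E n → ℝ} {x w : E n}
    (h : ∀ v, fderiv ℝ f x v = inner ℝ w v) : gradient f x = w :=
  ext_inner_right ℝ fun v => by rw [inner_gradient_left, h]

theorem gradient_ne_zero {f : E n → ℝ} {x : E n} (h : fderiv ℝ f x ≠ 0) : gradient f x ≠ 0 := by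
  intro h0
  apply h
  ext v
  rw [← inner_gradient_left, h0]
  simp

theorem contDiffAt_gradient {f : E n → ℝ} {x : E n} {m m' : WithTop ℕ∞}
    (hf : ContDiffAt ℝ m f x) (hm : m' + 1 ≤ m) : ContDiffAt ℝ m' (gradient f) x :=
  ((InnerProductSpace.toDual ℝ (E n)).symm.contDiff).contDiffAt.comp x (hf.fderiv_right hm)

namespace IsDefiningFunctionAt

theorem contDiffAt_unitGradient (h : IsDefiningFunctionAt Ω p φ) :
    ContDiffAt ℝ ∞ (unitGradient φ) p := by
  have hg : ContDiffAt ℝ ∞ (gradient φ) p := contDiffAt_gradient h.smooth.contDiffAt (by simp)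
  have h0 := gradient_ne_zero h.fderiv_ne_zero
  exact ((hg.norm ℝ h0).inv (norm_ne_zero_iff.mpr h0)).smul hg

theorem norm_unitGradient (h : IsDefiningFunctionAt Ω p φ) : ‖unitGradient φ p‖ = 1 := by
  have h0 := gradient_ne_zero h.fderiv_ne_zero
  rw [unitGradient, norm_smul, norm_inv, norm_norm, inv_mul_cancel₀ (norm_ne_zero_iff.mpr h0)]

theorem gradient_eq (h : IsDefiningFunctionAt Ω p φ) :
    gradient φ p = ‖gradient φ p‖ • unitGradient φ p := by
  have h0 := gradient_ne_zero h.fderiv_ne_zero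
  rw [unitGradient, smul_smul, mul_inv_cancel₀ (norm_ne_zero_iff.mpr h0), one_smul]

theorem eventually_isDefiningFunctionAt (h : IsDefiningFunctionAt Ω p φ) :
    ∀ᶠ q in 𝓝 p, IsDefiningFunctionAt Ω q φ := by
  have hc : Continuous (fderiv ℝ φ) := h.smooth.continuous_fderiv (by simp)
  filter_upwards [h.mem_iff.eventually_nhds, hc.continuousAt.eventually_ne h.fderiv_ne_zero]
    with q h1 h2
  exact ⟨h.smooth, h1, h2⟩

theorem eq_zero_of_mem_frontier (h : IsDefiningFunctionAt Ω p φ) (hΩ : IsOpen Ω)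
    (hp : p ∈ frontier Ω) : φ p = 0 := by
  have hn : p ∉ Ω := by
    rw [hΩ.frontier_eq] at hp
    exact hp.2
  have h1 : ¬ 0 < φ p := fun h0 => hn (h.mem_iff.self_of_nhds.mpr h0)
  refine le_antisymm (not_lt.mp h1) ?_
  have : (𝓝[Ω] p).NeBot := mem_closure_iff_nhdsWithin_neBot.mp hp.1
  refine ge_of_tendsto (h.smooth.continuous.continuousAt.mono_left
    (nhdsWithin_le_nhds (s := Ω))) ?_
  filter_upwards [self_mem_nhdsWithin, mem_nhdsWithin_of_mem_nhds h.mem_iff] with x hx hx'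
  exact (hx'.mp hx).le

theorem mem_frontier_of_eq_zero (h : IsDefiningFunctionAt Ω p φ) (h0 : φ p = 0) :
    p ∈ frontier Ω := by
  refine ⟨?_, fun hi => ?_⟩
  · rw [mem_closure_iff_frequently]
    intro hev
    have hmax : IsLocalMax φ p := by
      filter_upwards [hev, h.mem_iff] with x hx hx'
      rw [h0]
      exact not_lt.mp fun hpos => hx (hx'.mpr hpos)
    exact h.fderiv_ne_zero hmax.fderiv_eq_zero
  · have := h.mem_iff.self_of_nhds.mp (interior_subset hi)
    exact absurd this (by rw [h0]; exact lt_irrefl 0)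

theorem eventually_mem_frontier_iff (h : IsDefiningFunctionAt Ω p φ) (hΩ : IsOpen Ω) :
    ∀ᶠ q in 𝓝 p, (q ∈ frontier Ω ↔ φ q = 0) := by
  filter_upwards [h.eventually_isDefiningFunctionAt] with q hq
  exact ⟨hq.eq_zero_of_mem_frontier hΩ, hq.mem_frontier_of_eq_zero⟩

/-- Inverting `(q, t) ↦ (q + t N(q), φ(q))` near `(p, 0)`, where `N = ∇φ / |∇φ|`, produces smooth
functions `y` and `ρ` such that `x = y(x) + ρ(x) N(y(x))` and `y(x) ∈ {φ = 0}`. -/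
theorem exists_normal_coordinates (h : IsDefiningFunctionAt Ω p φ) (h0 : φ p = 0) :
    ∃ (y : E n → E n) (ρ : E n → ℝ), ContDiffAt ℝ ∞ y p ∧ ContDiffAt ℝ ∞ ρ p ∧ y p = p ∧ ρ p = 0 ∧
      (∀ᶠ x in 𝓝 p, y x + ρ x • unitGradient φ (y x) = x ∧ φ (y x) = 0) ∧
      ∀ᶠ z : E n × ℝ in 𝓝 (p, 0), φ z.1 = 0 →
        y (z.1 + z.2 • unitGradient φ z.1) = z.1 ∧ ρ (z.1 + z.2 • unitGradient φ z.1) = z.2 := by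
  set N := unitGradient φ with hN
  have hNs : ContDiffAt ℝ ∞ N p := h.contDiffAt_unitGradient
  set Φ : E n × ℝ → E n × ℝ := fun z => (z.1 + z.2 • N z.1, φ z.1) with hΦ
  have hNs' : ContDiffAt ℝ ∞ (fun z : E n × ℝ => N z.1) (p, 0) :=
    ContDiffAt.comp (p, (0 : ℝ)) (g := N) hNs contDiffAt_fst
  have hΦs : ContDiffAt ℝ ∞ Φ (p, 0) :=
    (contDiffAt_fst.add (contDiffAt_snd.smul hNs')).prodMk
      (h.smooth.contDiffAt.comp (p, (0 : ℝ)) contDiffAt_fst)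
  set L : E n × ℝ →L[ℝ] E n × ℝ :=
    ((ContinuousLinearMap.fst ℝ (E n) ℝ) + (ContinuousLinearMap.snd ℝ (E n) ℝ).smulRight (N p)).prod
      ((fderiv ℝ φ p).comp (ContinuousLinearMap.fst ℝ (E n) ℝ)) with hL
  have hLd : HasFDerivAt Φ L (p, 0) := by
    have h1 : HasFDerivAt (fun z : E n × ℝ => z.1) (ContinuousLinearMap.fst ℝ (E n) ℝ) (p, 0) :=
      hasFDerivAt_fst
    have h2 : HasFDerivAt (fun z : E n × ℝ => z.2) (ContinuousLinearMap.snd ℝ (E n) ℝ) (p, 0) :=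
      hasFDerivAt_snd
    have h3 := (hNs'.differentiableAt (by simp)).hasFDerivAt
    have h4 : HasFDerivAt (fun z : E n × ℝ => φ z.1)
        ((fderiv ℝ φ p).comp (ContinuousLinearMap.fst ℝ (E n) ℝ)) (p, 0) :=
      HasFDerivAt.comp (p, (0 : ℝ)) (g := φ)
        (h.smooth.contDiffAt.differentiableAt (by simp)).hasFDerivAt h1
    refine ((h1.add (h2.smul h3)).prodMk h4).congr_fderiv ?_
    simp [hL]
  have hdN : fderiv ℝ φ p (N p) = ‖gradient φ p‖ := by
    rw [← inner_gradient_left, h.gradient_eq, real_inner_smul_left, real_inner_self_eq_norm_sq,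
      h.norm_unitGradient, norm_smul, norm_norm, h.norm_unitGradient]
    simp
  have hg0 : ‖gradient φ p‖ ≠ 0 := norm_ne_zero_iff.mpr (gradient_ne_zero h.fderiv_ne_zero)
  have hinj : Function.Injective (L : E n × ℝ →ₗ[ℝ] E n × ℝ) := by
    rw [← LinearMap.ker_eq_bot, LinearMap.ker_eq_bot']
    rintro ⟨v, t⟩ hvt
    have e1 : v + t • N p = 0 := by simpa [hL] using congrArg Prod.fst hvt
    have e2 : fderiv ℝ φ p v = 0 := by simpa [hL] using congrArg Prod.snd hvt
    have e3 : t * ‖gradient φ p‖ = 0 := by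
      have := congrArg (fderiv ℝ φ p) e1
      simpa [e2, hdN] using this
    have ht : t = 0 := (mul_eq_zero.mp e3).resolve_right hg0
    rw [ht, zero_smul, add_zero] at e1
    rw [e1, ht]
    rfl
  set L' : (E n × ℝ) ≃L[ℝ] (E n × ℝ) :=
    (LinearEquiv.ofInjectiveEndo (L : E n × ℝ →ₗ[ℝ] E n × ℝ) hinj).toContinuousLinearEquiv with hL'
  have hLL : (L' : E n × ℝ →L[ℝ] E n × ℝ) = L :=
    ContinuousLinearMap.ext fun z => rfl
  have hLd' : HasFDerivAt Φ (L' : E n × ℝ →L[ℝ] E n × ℝ) (p, 0) := by rwa [hLL]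
  have hΦp : Φ (p, 0) = (p, 0) := by simp [hΦ, h0]
  set Ψ := hΦs.localInverse hLd' (by simp) with hΨ
  have hΨs : ContDiffAt ℝ ∞ Ψ (p, 0) := by
    have := hΦs.to_localInverse hLd' (by simp)
    rwa [hΦp] at this
  have hstrict := hΦs.hasStrictFDerivAt' hLd' (by simp)
  have hleft : ∀ᶠ z in 𝓝 (p, (0 : ℝ)), Ψ (Φ z) = z := hstrict.eventually_left_inverse
  have hright : ∀ᶠ z in 𝓝 (p, (0 : ℝ)), Φ (Ψ z) = z := by
    have := hstrict.eventually_right_inverse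
    rwa [hΦp] at this
  have hι : ContDiff ℝ ∞ (fun x : E n => (x, (0 : ℝ))) := contDiff_id.prodMk contDiff_const
  have hιs : ContDiffAt ℝ ∞ (fun x : E n => Ψ (x, 0)) p :=
    ContDiffAt.comp p (g := Ψ) hΨs hι.contDiffAt
  have hΨp : Ψ (p, 0) = (p, 0) := by
    have := hleft.self_of_nhds
    rwa [hΦp] at this
  refine ⟨fun x => (Ψ (x, 0)).1, fun x => (Ψ (x, 0)).2, contDiffAt_fst.comp p hιs,
    contDiffAt_snd.comp p hιs, by simp [hΨp], by simp [hΨp], ?_, ?_⟩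
  · have ht : Tendsto (fun x : E n => (x, (0 : ℝ))) (𝓝 p) (𝓝 (p, 0)) := hι.continuous.tendsto p
    filter_upwards [ht.eventually hright] with x hx
    exact ⟨congrArg Prod.fst hx, congrArg Prod.snd hx⟩
  · filter_upwards [hleft] with z hz hz0
    have : Φ z = (z.1 + z.2 • N z.1, 0) := by simp [hΦ, hz0]
    rw [this] at hz
    simp [hz]

end IsDefiningFunctionAt

theorem inner_fderiv_of_norm_eq_one {N : E n → E n} {x : E n} (hN : DifferentiableAt ℝ N x)
    (h1 : ∀ᶠ z in 𝓝 x, ‖N z‖ = 1) (v : E n) : inner ℝ (fderiv ℝ N x v) (N x) = 0 := by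
  have h2 : (fun z => inner ℝ (N z) (N z)) =ᶠ[𝓝 x] fun _ => (1 : ℝ) := by
    filter_upwards [h1] with z hz
    rw [real_inner_self_eq_norm_sq, hz, one_pow]
  have h3 := fderiv_inner_apply ℝ hN hN v
  rw [h2.fderiv_eq] at h3
  simp only [fderiv_fun_const, Pi.zero_apply, _root_.zero_apply] at h3
  rw [real_inner_comm] at h3
  linarith

namespace IsDefiningFunctionAt

/-- In normal coordinates the gradient of the second coordinate is the normal at the foot point. -/
theorem gradient_eq_of_normal_coordinates {y : E n → E n} {ρ : E n → ℝ} {x : E n}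
    (h : IsDefiningFunctionAt Ω (y x) φ) (hy : DifferentiableAt ℝ y x)
    (hρ : DifferentiableAt ℝ ρ x)
    (hx : ∀ᶠ z in 𝓝 x, y z + ρ z • unitGradient φ (y z) = z ∧ φ (y z) = 0) :
    gradient ρ x = unitGradient φ (y x) := by
  set N := unitGradient φ with hN
  have hNd : DifferentiableAt ℝ N (y x) := h.contDiffAt_unitGradient.differentiableAt (by simp)
  have h1 : ∀ᶠ z in 𝓝 (y x), ‖N z‖ = 1 :=
    h.eventually_isDefiningFunctionAt.mono fun z hz => hz.norm_unitGradient
  have hφd : DifferentiableAt ℝ φ (y x) := h.smooth.contDiffAt.differentiableAt (by simp)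
  refine eq_gradient_of_inner fun v => ?_
  have e1 : fderiv ℝ φ (y x) (fderiv ℝ y x v) = 0 := by
    have hc : (fun z => φ (y z)) =ᶠ[𝓝 x] fun _ => (0 : ℝ) := hx.mono fun z hz => hz.2
    have h2 := (hφd.hasFDerivAt.comp x hy.hasFDerivAt).fderiv
    have h3 : fderiv ℝ (φ ∘ y) x = fderiv ℝ (fun _ => (0 : ℝ)) x := hc.fderiv_eq
    rw [h2] at h3
    simpa using congrArg (fun L => L v) h3
  have e2 : inner ℝ (N (y x)) (fderiv ℝ y x v) = 0 := by
    rw [← inner_gradient_left, h.gradient_eq, real_inner_smul_left] at e1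
    exact (mul_eq_zero.mp e1).resolve_left
      (norm_ne_zero_iff.mpr (gradient_ne_zero h.fderiv_ne_zero))
  have hc : (fun z => y z + ρ z • N (y z)) =ᶠ[𝓝 x] fun z => z := hx.mono fun z hz => hz.1
  have hd := hy.hasFDerivAt.add
    (hρ.hasFDerivAt.smul (hNd.hasFDerivAt.comp x hy.hasFDerivAt))
  have e3 := hc.fderiv_eq.symm.trans hd.fderiv
  have e4 := congrArg (fun L => inner ℝ (N (y x)) (L v)) e3
  have e5 := inner_fderiv_of_norm_eq_one hNd h1 (fderiv ℝ y x v)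
  rw [real_inner_comm] at e5
  simp [inner_add_right, real_inner_smul_right, e2, e5, hN ▸ h.norm_unitGradient] at e4
  rw [e4]

/-- A nearest boundary point is joined to `x` by a normal segment, by Lagrange multipliers. -/
theorem exists_smul_unitGradient_of_nearest (h : IsDefiningFunctionAt Ω p φ) (hΩ : IsOpen Ω)
    (hp : p ∈ frontier Ω) {x : E n} (hx : dist x p = Metric.infDist x (frontier Ω)) :
    ∃ t : ℝ, x = p + t • unitGradient φ p := by
  have hmin : IsLocalMinOn (fun z => ‖x - z‖ ^ 2) {z | φ z = φ p} p := by
    have hev := mem_nhdsWithin_of_mem_nhds (t := {z | φ z = φ p}) (h.eventually_mem_frontier_iff hΩ)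
    filter_upwards [hev, self_mem_nhdsWithin] with z hz hz'
    have hzf : z ∈ frontier Ω := by
      rw [hz, hz', h.eq_zero_of_mem_frontier hΩ hp]
    have := Metric.infDist_le_dist_of_mem (x := x) hzf
    rw [← hx, dist_eq_norm, dist_eq_norm] at this
    gcongr
  have hs : HasStrictFDerivAt φ (fderiv ℝ φ p) p :=
    h.smooth.contDiffAt.hasStrictFDerivAt (by simp)
  have hq : HasStrictFDerivAt (fun z : E n => ‖x - z‖ ^ 2)
      (-(2 • innerSL ℝ (x - p))) p := by
    have := ((hasStrictFDerivAt_norm_sq (x - p)).comp p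
      ((hasStrictFDerivAt_id p).const_sub x))
    refine this.congr_fderiv ?_
    ext v
    simp
  obtain ⟨a, b, hab, h0⟩ :=
    IsLocalExtrOn.exists_multipliers_of_hasStrictFDerivAt_1d (Or.inl hmin) hs hq
  have hb : b ≠ 0 := by
    rintro rfl
    rw [zero_smul, add_zero] at h0
    rcases smul_eq_zero.mp h0 with ha | ha
    · exact hab (by rw [ha]; rfl)
    · exact h.fderiv_ne_zero ha
  have key : a • gradient φ p = (2 * b) • (x - p) := by
    refine ext_inner_right ℝ fun v => ?_
    have h1 := congrArg (fun L => L v) h0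
    simp only [_root_.add_apply, _root_.smul_apply, _root_.neg_apply, innerSL_apply_apply,
      smul_eq_mul, nsmul_eq_mul, _root_.zero_apply] at h1
    rw [real_inner_smul_left, real_inner_smul_left, inner_gradient_left]
    push_cast at h1
    linarith
  refine ⟨(2 * b)⁻¹ * a * ‖gradient φ p‖, ?_⟩
  rw [mul_smul, ← h.gradient_eq, mul_smul, key, smul_smul, inv_mul_cancel₀ (by simpa using hb),
    one_smul]
  abel

end IsDefiningFunctionAt

/-- Normal coordinates of `Ω` near the boundary point `p`: near `p` every point is
`x = y(x) + ρ(x) ∇ρ(x)` with `y(x) ∈ ∂Ω` and `|∇ρ| = 1`. On the side of `Ω`, `ρ` is the distance to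
the boundary and `y` the foot point. The function `y` is constant near `p` on the normal line
through `p`, and the second fundamental form at `p` is minus the Hessian of `ρ`. Identities that
hold for `bdist` and `footPoint` only inside `Ω` are thereby available in a full neighbourhood of
`p`. -/
structure IsNormalCoordinates (Ω : Set (E n)) (p : E n) (y : E n → E n) (ρ : E n → ℝ) : Prop where
  smooth_foot : ContDiffAt ℝ ∞ y p
  smooth_dist : ContDiffAt ℝ ∞ ρ p
  foot_self : y p = p
  dist_self : ρ p = 0
  foot_line : ∀ᶠ t : ℝ in 𝓝 0, y (p + t • gradient ρ p) = p
  foot_mem : ∀ᶠ x in 𝓝 p, y x ∈ frontier Ω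
  foot_add : ∀ᶠ x in 𝓝 p, y x + ρ x • gradient ρ x = x
  norm_gradient : ∀ᶠ x in 𝓝 p, ‖gradient ρ x‖ = 1
  eventually_eq : ∀ᶠ x in 𝓝[Ω] p, 0 < ρ x ∧ bdist Ω x = ρ x ∧ footPoint Ω x = y x
  gradient_eq : gradient ρ p = innerNormal Ω p
  form_eq : ∀ X Y : tangentPlane Ω p,
    secondFundamentalForm Ω p X Y = -inner ℝ (fderiv ℝ (gradient ρ) p X) (Y : E n)

theorem IsBoundedSmoothDomain.isCompact_frontier (hΩ : IsBoundedSmoothDomain Ω) :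
    IsCompact (frontier Ω) :=
  Metric.isCompact_of_isClosed_isBounded isClosed_frontier
    (hΩ.isBounded.closure.subset frontier_subset_closure)

theorem isDefiningFunctionAt_definingFunction (hΩ : IsBoundedSmoothDomain Ω)
    (hp : p ∈ frontier Ω) : IsDefiningFunctionAt Ω p (definingFunction Ω p) :=
  Classical.epsilon_spec (hΩ.smooth_boundary p hp)

theorem footPoint_spec (hΩ : IsBoundedSmoothDomain Ω) (hne : (frontier Ω).Nonempty) (x : E n) :
    footPoint Ω x ∈ frontier Ω ∧ dist x (footPoint Ω x) = bdist Ω x := by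
  obtain ⟨q, hq, hd⟩ := hΩ.isCompact_frontier.exists_infDist_eq_dist hne x
  exact Classical.epsilon_spec (p := fun q => q ∈ frontier Ω ∧ dist x q =
    Metric.infDist x (frontier Ω)) ⟨q, hq, hd.symm⟩

theorem tendsto_bdist_nhds (hp : p ∈ frontier Ω) : Tendsto (bdist Ω) (𝓝 p) (𝓝 0) := by
  have := (Metric.continuous_infDist_pt (frontier Ω)).tendsto p
  rwa [Metric.infDist_zero_of_mem hp] at this

theorem tendsto_footPoint (hΩ : IsBoundedSmoothDomain Ω) (hp : p ∈ frontier Ω) :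
    Tendsto (footPoint Ω) (𝓝 p) (𝓝 p) := by
  rw [tendsto_iff_dist_tendsto_zero]
  have h1 : Tendsto (fun x => bdist Ω x + dist x p) (𝓝 p) (𝓝 (0 + dist p p)) :=
    (tendsto_bdist_nhds hp).add (continuous_id.dist continuous_const).continuousAt
  rw [dist_self, add_zero] at h1
  refine squeeze_zero (fun _ => dist_nonneg) (fun x => ?_) h1
  rw [← (footPoint_spec hΩ ⟨p, hp⟩ x).2, dist_comm x]
  exact dist_triangle _ _ _

/-- Normal coordinates exist at every boundary point. The second coordinate of the inverse of
`(q, t) ↦ q + t N(q)` is the distance up to sign, because a nearest boundary point is the foot of a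
normal segment and is close to `p`. -/
theorem exists_isNormalCoordinates (hΩ : IsBoundedSmoothDomain Ω) (hp : p ∈ frontier Ω) :
    ∃ (y : E n → E n) (ρ : E n → ℝ), IsNormalCoordinates Ω p y ρ := by
  have h := isDefiningFunctionAt_definingFunction hΩ hp
  set φ := definingFunction Ω p with hφ
  have h0 := h.eq_zero_of_mem_frontier hΩ.isOpen hp
  obtain ⟨y, ρ, hy, hρ, hyp, hρp, hxy, hq⟩ := h.exists_normal_coordinates h0
  set N := unitGradient φ with hN
  have hyt : Tendsto y (𝓝 p) (𝓝 p) := by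
    have := hy.continuousAt.tendsto
    rwa [hyp] at this
  have hρt : Tendsto ρ (𝓝 p) (𝓝 0) := by
    have := hρ.continuousAt.tendsto
    rwa [hρp] at this
  have hdef : ∀ᶠ x in 𝓝 p, IsDefiningFunctionAt Ω (y x) φ :=
    hyt.eventually h.eventually_isDefiningFunctionAt
  have hgrad : ∀ᶠ x in 𝓝 p, gradient ρ x = N (y x) := by
    have hy1 : ContDiffAt ℝ 1 y p := hy.of_le (by simp)
    have hρ1 : ContDiffAt ℝ 1 ρ p := hρ.of_le (by simp)
    filter_upwards [hdef, hxy.eventually_nhds, hy1.eventually (by simp),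
      hρ1.eventually (by simp)] with x h1 h2 h3 h4
    exact h1.gradient_eq_of_normal_coordinates (h3.differentiableAt (by simp))
      (h4.differentiableAt (by simp)) h2
  have hadd : ∀ᶠ x in 𝓝 p, y x + ρ x • gradient ρ x = x := by
    filter_upwards [hgrad, hxy] with x h1 h2
    rw [h1, h2.1]
  have hnorm : ∀ᶠ x in 𝓝 p, ‖gradient ρ x‖ = 1 := by
    filter_upwards [hgrad, hdef] with x h1 h2
    rw [h1, h2.norm_unitGradient]
  have hmem : ∀ᶠ x in 𝓝 p, y x ∈ frontier Ω := by
    filter_upwards [hxy, hdef] with x h1 h2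
    exact h2.mem_frontier_of_eq_zero h1.2
  have hNp : ‖N p‖ = 1 := h.norm_unitGradient
  have hNd : DifferentiableAt ℝ N p := h.contDiffAt_unitGradient.differentiableAt (by simp)
  have hgp : gradient ρ p = N p := by rw [hgrad.self_of_nhds, hyp]
  refine ⟨y, ρ, hy, hρ, hyp, hρp, ?_, hmem, hadd, hnorm, ?_, hgp, ?_⟩
  · have ht : Tendsto (fun t : ℝ => (p, t)) (𝓝 0) (𝓝 (p, 0)) :=
      tendsto_const_nhds.prodMk_nhds tendsto_id
    filter_upwards [ht.eventually hq] with t h1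
    rw [hgp]
    exact (h1 h0).1
  · -- a nearest boundary point `q` lies near `p` and satisfies `x = q + t N(q)`
    have hfoot : ∀ᶠ x in 𝓝 p, y x = footPoint Ω x ∧ |ρ x| = bdist Ω x := by
      set s : E n → ℝ := fun x => inner ℝ (x - footPoint Ω x) (N (footPoint Ω x)) with hs
      have hft := tendsto_footPoint hΩ hp
      have hst : Tendsto s (𝓝 p) (𝓝 0) := by
        have h1 : Tendsto (fun x : E n => x - footPoint Ω x) (𝓝 p) (𝓝 (p - p)) :=
          tendsto_id.sub hft
        have h2 := h1.inner (𝕜 := ℝ) (hNd.continuousAt.tendsto.comp hft)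
        simpa using h2
      filter_upwards [(hft.prodMk_nhds hst).eventually hq,
        hft.eventually h.eventually_isDefiningFunctionAt] with x h1 h2
      obtain ⟨hmemx, hdist⟩ := footPoint_spec hΩ ⟨p, hp⟩ x
      obtain ⟨t, ht⟩ := h2.exists_smul_unitGradient_of_nearest hΩ.isOpen hmemx hdist
      have hxt : x - footPoint Ω x = t • N (footPoint Ω x) := sub_eq_iff_eq_add'.mpr ht
      have hn1 : ‖N (footPoint Ω x)‖ = 1 := h2.norm_unitGradient
      have hsx : s x = t := by
        simp only [hs]
        rw [hxt, real_inner_smul_left, real_inner_self_eq_norm_sq, hn1]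
        simp
      have h3 := h1 (h2.eq_zero_of_mem_frontier hΩ.isOpen hmemx)
      simp only [hsx] at h3
      rw [← ht] at h3
      refine ⟨h3.1, ?_⟩
      rw [h3.2, ← hdist, dist_eq_norm, hxt, norm_smul, hn1, mul_one, Real.norm_eq_abs]
    -- `φ` is strictly differentiable at `p` and increases along the normals, so `φ` and `ρ` have
    -- the same sign near `p`
    have hsign : ∀ᶠ x in 𝓝 p, x ∈ Ω → 0 < ρ x := by
      set G := ‖gradient φ p‖ with hG
      have hGpos : 0 < G := norm_pos_iff.mpr (gradient_ne_zero h.fderiv_ne_zero)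
      have hstr : HasStrictFDerivAt φ (fderiv ℝ φ p) p :=
        h.smooth.contDiffAt.hasStrictFDerivAt (by simp)
      have hdN : fderiv ℝ φ p (N p) = G := by
        rw [← inner_gradient_left, h.gradient_eq, real_inner_smul_left,
          real_inner_self_eq_norm_sq, hNp]
        simp [hG]
      have ht : Tendsto (fun x => fderiv ℝ φ p (N (y x))) (𝓝 p) (𝓝 G) := by
        rw [← hdN]
        exact ((fderiv ℝ φ p).continuous.tendsto _).comp (hNd.continuousAt.tendsto.comp hyt)
      have hpair : Tendsto (fun x : E n => (x, y x)) (𝓝 p) (𝓝 (p, p)) := tendsto_id.prodMk_nhds hyt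
      filter_upwards [ht.eventually_const_lt (half_lt_self hGpos), hxy, hdef,
        hpair.eventually (hstr.isLittleO.def (by positivity : 0 < G / 4)), h.mem_iff]
        with x h1 h2 h3 h4 h5 hxΩ
      have hpos := h5.mp hxΩ
      by_contra hneg
      have hxy' : x - y x = ρ x • N (y x) := sub_eq_iff_eq_add'.mpr h2.1.symm
      have hn1 : ‖N (y x)‖ = 1 := h3.norm_unitGradient
      simp only [hxy', map_smul, smul_eq_mul, h2.2, sub_zero, norm_smul, hn1, mul_one,
        Real.norm_eq_abs] at h4
      rw [abs_of_nonpos (not_lt.mp hneg)] at h4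
      have h6 := (abs_le.mp h4).2
      nlinarith [mul_nonneg (neg_nonneg.mpr (not_lt.mp hneg)) (sub_nonneg.mpr h1.le)]
    filter_upwards [mem_nhdsWithin_of_mem_nhds hfoot, mem_nhdsWithin_of_mem_nhds hsign,
      self_mem_nhdsWithin] with x h1 h2 h3
    exact ⟨h2 h3, by rw [← h1.2, abs_of_pos (h2 h3)], h1.1.symm⟩
  · intro X Y
    have e1 : HasFDerivAt y (fderiv ℝ y p) p := (hy.differentiableAt (by simp)).hasFDerivAt
    have e2 : fderiv ℝ (gradient ρ) p = (fderiv ℝ N p).comp (fderiv ℝ y p) := by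
      have : gradient ρ =ᶠ[𝓝 p] N ∘ y := hgrad
      rw [this.fderiv_eq]
      have hNd' : HasFDerivAt N (fderiv ℝ N p) (y p) := by
        rw [hyp]
        exact hNd.hasFDerivAt
      exact (hNd'.comp p e1).fderiv
    have hX : inner ℝ (N p) (X : E n) = 0 :=
      Submodule.mem_orthogonal_singleton_iff_inner_right.mp X.2
    have e3 : fderiv ℝ y p X = X := by
      have hc : (fun z => y z + ρ z • gradient ρ z) =ᶠ[𝓝 p] fun z => z := hadd
      have hg : DifferentiableAt ℝ (gradient ρ) p :=
        (contDiffAt_gradient (m' := ∞) hρ (by simp)).differentiableAt (by simp)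
      have hd := e1.add ((hρ.differentiableAt (by simp)).hasFDerivAt.smul hg.hasFDerivAt)
      have e4 := congrArg (fun L => L (X : E n)) (hc.fderiv_eq.symm.trans hd.fderiv)
      simp only [fderiv_fun_id, ContinuousLinearMap.id_apply, _root_.add_apply, hρp, zero_smul,
        ContinuousLinearMap.smulRight_apply, ← inner_gradient_left, hgp, hX,
        add_zero, zero_add] at e4
      exact e4.symm
    rw [e2]
    simp only [ContinuousLinearMap.comp_apply, e3]
    rfl

end Boundary

/-! ### Partial derivatives -/

theorem natCast_le_infty (m : ℕ) : (m : WithTop ℕ∞) ≤ ∞ :=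
  WithTop.coe_le_coe.mpr le_top

section Calculus

variable {n : ℕ} {u w : E n → ℝ} {x : E n}

theorem partialDeriv_congr (h : u =ᶠ[𝓝 x] w) (i : Fin n) :
    partialDeriv i u =ᶠ[𝓝 x] partialDeriv i w := by
  filter_upwards [h.fderiv (𝕜 := ℝ)] with z hz
  rw [partialDeriv, hz, partialDeriv]

theorem partialDeriv_add (hu : DifferentiableAt ℝ u x) (hw : DifferentiableAt ℝ w x) (i : Fin n) :
    partialDeriv i (fun z => u z + w z) x = partialDeriv i u x + partialDeriv i w x := by
  simp only [partialDeriv, fderiv_fun_add hu hw, _root_.add_apply]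

theorem partialDeriv_mul (hu : DifferentiableAt ℝ u x) (hw : DifferentiableAt ℝ w x) (i : Fin n) :
    partialDeriv i (fun z => u z * w z) x
      = partialDeriv i u x * w x + u x * partialDeriv i w x := by
  simp only [partialDeriv, fderiv_fun_mul hu hw, _root_.add_apply, _root_.smul_apply, smul_eq_mul]
  ring

theorem partialDeriv_comp {f : ℝ → ℝ} {f' : ℝ} (hf : HasDerivAt f f' (u x))
    (hu : DifferentiableAt ℝ u x) (i : Fin n) :
    partialDeriv i (fun z => f (u z)) x = f' * partialDeriv i u x := by
  simp only [partialDeriv]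
  have h : fderiv ℝ (fun z => f (u z)) x = f' • fderiv ℝ u x :=
    (hf.comp_hasFDerivAt x hu.hasFDerivAt).fderiv
  rw [h]
  simp

theorem partialDeriv_sum {ι : Type*} {s : Finset ι} {f : ι → E n → ℝ}
    (hf : ∀ a ∈ s, DifferentiableAt ℝ (f a) x) (i : Fin n) :
    partialDeriv i (fun z => ∑ a ∈ s, f a z) x = ∑ a ∈ s, partialDeriv i (f a) x := by
  simp only [partialDeriv]
  rw [fderiv_fun_sum hf]
  simp

theorem contDiffAt_partialDeriv {m m' : WithTop ℕ∞} (hu : ContDiffAt ℝ m u x) (hm : m' + 1 ≤ m)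
    (i : Fin n) : ContDiffAt ℝ m' (partialDeriv i u) x :=
  (hu.fderiv_right hm).clm_apply contDiffAt_const

theorem partialDeriv_partialDeriv (hu : ContDiffAt ℝ 2 u x) (i j : Fin n) :
    partialDeriv i (partialDeriv j u) x
      = fderiv ℝ (fderiv ℝ u) x (EuclideanSpace.single i 1) (EuclideanSpace.single j 1) := by
  have hd : DifferentiableAt ℝ (fderiv ℝ u) x :=
    (hu.fderiv_right (m := 1) le_rfl).differentiableAt (by simp)
  have h := (hd.hasFDerivAt.clm_apply
    (hasFDerivAt_const (EuclideanSpace.single j (1 : ℝ)) x)).fderiv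
  change fderiv ℝ (fun z => fderiv ℝ u z (EuclideanSpace.single j 1)) x _ = _
  rw [h]
  simp

theorem partialDeriv_comm (hu : ContDiffAt ℝ 2 u x) (i j : Fin n) :
    partialDeriv i (partialDeriv j u) x = partialDeriv j (partialDeriv i u) x := by
  rw [partialDeriv_partialDeriv hu, partialDeriv_partialDeriv hu]
  exact hu.isSymmSndFDerivAt (by simp) _ _

theorem inner_fderiv_gradient (hu : ContDiffAt ℝ 2 u x) (v z : E n) :
    inner ℝ (fderiv ℝ (gradient u) x v) z = fderiv ℝ (fderiv ℝ u) x v z := by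
  have hd : DifferentiableAt ℝ (fderiv ℝ u) x :=
    (hu.fderiv_right (m := 1) le_rfl).differentiableAt (by simp)
  have h := ((InnerProductSpace.toDual ℝ (E n)).symm.toContinuousLinearEquiv.hasFDerivAt.comp x
    hd.hasFDerivAt).fderiv
  have h' : fderiv ℝ (gradient u) x v
      = (InnerProductSpace.toDual ℝ (E n)).symm (fderiv ℝ (fderiv ℝ u) x v) :=
    congrArg (fun L => L v) h
  rw [h', InnerProductSpace.toDual_symm_apply]

theorem fderiv_apply_eq_sum (v : E n) :
    fderiv ℝ u x v = ∑ i, v i * partialDeriv i u x := by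
  have hv : v = ∑ i, v i • EuclideanSpace.single i (1 : ℝ) := by
    ext j
    simp [Finset.sum_apply, Pi.single_apply]
  conv_lhs => rw [hv]
  simp [partialDeriv]

theorem norm_gradient_sq : ‖gradient u x‖ ^ 2 = ∑ i, partialDeriv i u x ^ 2 := by
  rw [EuclideanSpace.norm_sq_eq]
  simp [gradient_apply]

end Calculus

/-! ### Traces of bilinear forms on a hyperplane -/

section Forms

variable {V : Type*} [NormedAddCommGroup V] [InnerProductSpace ℝ V] [FiniteDimensional ℝ V]

/-- A form on a subspace that comes from an endomorphism vanishing on the orthogonal complement has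
the trace of that endomorphism. -/
theorem formTrace_of_subspace (K : Submodule ℝ V) (T : V →ₗ[ℝ] V) (hT : ∀ z ∈ Kᗮ, T z = 0)
    (B : LinearMap.BilinForm ℝ K) (hB : ∀ X Y : K, B X Y = inner ℝ (T X) (Y : V)) :
    formTrace B = LinearMap.trace ℝ V T := by
  let P : V →ₗ[ℝ] K := K.orthogonalProjectionOnto
  have h1 : T ∘ₗ (K.subtype ∘ₗ P) = T := by
    ext v
    have h := hT _ (K.sub_starProjection_mem_orthogonal v)
    rw [map_sub, sub_eq_zero] at h
    exact h.symm
  have h2 : LinearMap.trace ℝ V T = LinearMap.trace ℝ K (P ∘ₗ (T ∘ₗ K.subtype)) := by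
    conv_lhs => rw [← h1, ← LinearMap.comp_assoc]
    exact LinearMap.trace_comp_comm' P (T ∘ₗ K.subtype)
  rw [h2, LinearMap.trace_eq_sum_inner _ (stdOrthonormalBasis ℝ K), formTrace]
  refine Finset.sum_congr rfl fun a _ => ?_
  rw [hB, real_inner_comm]
  exact (K.inner_orthogonalProjectionOnto_eq_of_mem_left _ _).symm

/-- The analogue of `formTrace_of_subspace` for the squared norm, which is `tr T²` if `T` is
symmetric. -/
theorem formNormSq_of_subspace (K : Submodule ℝ V) (T : V →ₗ[ℝ] V) (hT : ∀ z ∈ Kᗮ, T z = 0)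
    (hs : T.IsSymmetric)
    (B : LinearMap.BilinForm ℝ K) (hB : ∀ X Y : K, B X Y = inner ℝ (T X) (Y : V)) :
    formNormSq B = LinearMap.trace ℝ V (T ∘ₗ T) := by
  have hTK : ∀ X : K, T X ∈ K := by
    intro X
    have h := Submodule.mem_orthogonal (K := Kᗮ) (v := T X)
    rw [K.orthogonal_orthogonal] at h
    refine h.mpr fun z hz => ?_
    rw [← hs, hT z hz, inner_zero_left]
  let B' : LinearMap.BilinForm ℝ K := LinearMap.BilinForm.restrict ((innerₗ V).comp (T ∘ₗ T)) K
  have hB' : ∀ X Y : K, B' X Y = inner ℝ ((T ∘ₗ T) X) (Y : V) := fun X Y => rfl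
  rw [← formTrace_of_subspace K (T ∘ₗ T) (fun z hz => by simp [hT z hz]) B' hB', formTrace,
    formNormSq]
  refine Finset.sum_congr rfl fun a _ => ?_
  set b := stdOrthonormalBasis ℝ K
  have h := b.sum_sq_norm_inner_left (⟨T (b a), hTK _⟩ : K)
  rw [hB', LinearMap.comp_apply, hs, real_inner_self_eq_norm_sq]
  simp only [hB]
  refine Eq.trans ?_ h
  refine Finset.sum_congr rfl fun c _ => ?_
  rw [Real.norm_eq_abs, sq_abs]
  rfl

theorem formNormSq_sub_smul_inner (B : LinearMap.BilinForm ℝ V) (c : ℝ) :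
    formNormSq (B - c • innerₗ V)
      = formNormSq B - 2 * c * formTrace B + c ^ 2 * Module.finrank ℝ V := by
  set b := stdOrthonormalBasis ℝ V with hb
  have h : ∀ i j, (B - c • innerₗ V) (b i) (b j) ^ 2
      = B (b i) (b j) ^ 2 - 2 * c * (if i = j then B (b i) (b i) else 0)
        + c ^ 2 * (if i = j then 1 else 0) := by
    intro i j
    simp only [LinearMap.sub_apply, LinearMap.smul_apply, innerₗ_apply_apply, smul_eq_mul,
      orthonormal_iff_ite.mp b.orthonormal i j]
    split_ifs with hij
    · subst hij
      ring
    · ring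
  simp only [formNormSq, formTrace, ← hb, h, Finset.sum_add_distrib, Finset.sum_sub_distrib,
    ← Finset.mul_sum, Finset.sum_ite_eq, Finset.mem_univ, if_true]
  simp

end Forms

/-! ### The curvature of the boundary in normal coordinates -/

namespace IsNormalCoordinates

variable {n : ℕ} {Ω : Set (E n)} {p : E n} {y : E n → E n} {ρ : E n → ℝ}

theorem smooth_two (h : IsNormalCoordinates Ω p y ρ) : ContDiffAt ℝ 2 ρ p :=
  h.smooth_dist.of_le (natCast_le_infty 2)

theorem isSymmetric_fderiv_gradient (h : IsNormalCoordinates Ω p y ρ) :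
    (fderiv ℝ (gradient ρ) p : E n →ₗ[ℝ] E n).IsSymmetric := by
  intro v z
  have h1 := inner_fderiv_gradient h.smooth_two v z
  have h2 := inner_fderiv_gradient h.smooth_two z v
  rw [real_inner_comm] at h2
  exact h1.trans ((h.smooth_two.isSymmSndFDerivAt (by simp) v z).trans h2.symm)

theorem fderiv_gradient_gradient (h : IsNormalCoordinates Ω p y ρ) :
    fderiv ℝ (gradient ρ) p (gradient ρ p) = 0 := by
  refine ext_inner_right ℝ fun v => ?_
  have hg : DifferentiableAt ℝ (gradient ρ) p :=
    (contDiffAt_gradient (m' := 1) h.smooth_two le_rfl).differentiableAt (by simp)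
  have h1 := inner_fderiv_of_norm_eq_one hg h.norm_gradient v
  rw [inner_zero_left]
  exact (h.isSymmetric_fderiv_gradient _ _).trans ((real_inner_comm _ _).trans h1)

theorem fderiv_gradient_of_mem_orthogonal (h : IsNormalCoordinates Ω p y ρ) (z : E n)
    (hz : z ∈ (tangentPlane Ω p)ᗮ) : fderiv ℝ (gradient ρ) p z = 0 := by
  rw [Submodule.orthogonal_orthogonal, Submodule.mem_span_singleton, ← h.gradient_eq] at hz
  obtain ⟨t, rfl⟩ := hz
  rw [map_smul, h.fderiv_gradient_gradient, smul_zero]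

theorem inner_fderiv_gradient_single (h : IsNormalCoordinates Ω p y ρ) (i j : Fin n) :
    inner ℝ (fderiv ℝ (gradient ρ) p (EuclideanSpace.basisFun (Fin n) ℝ i))
      (EuclideanSpace.basisFun (Fin n) ℝ j) = partialDeriv i (partialDeriv j ρ) p := by
  rw [inner_fderiv_gradient h.smooth_two, partialDeriv_partialDeriv h.smooth_two]
  simp

/-- At the base point `H = -Δρ`. -/
theorem meanCurvature_eq (h : IsNormalCoordinates Ω p y ρ) :
    meanCurvature Ω p = -∑ i, partialDeriv i (partialDeriv i ρ) p := by
  have h1 := formTrace_of_subspace (tangentPlane Ω p)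
    (-(fderiv ℝ (gradient ρ) p : E n →ₗ[ℝ] E n))
    (fun z hz => by simp [h.fderiv_gradient_of_mem_orthogonal z hz])
    (secondFundamentalForm Ω p) (fun X Y => by rw [h.form_eq]; simp)
  rw [meanCurvature, h1, map_neg,
    LinearMap.trace_eq_sum_inner _ (EuclideanSpace.basisFun (Fin n) ℝ)]
  congr 1
  refine Finset.sum_congr rfl fun i _ => ?_
  rw [real_inner_comm]
  exact h.inner_fderiv_gradient_single i i

/-- At the base point `|Π|² = |∇²ρ|²`. -/
theorem formNormSq_eq (h : IsNormalCoordinates Ω p y ρ) :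
    formNormSq (secondFundamentalForm Ω p)
      = ∑ i, ∑ j, partialDeriv i (partialDeriv j ρ) p ^ 2 := by
  have h1 := formNormSq_of_subspace (tangentPlane Ω p)
    (-(fderiv ℝ (gradient ρ) p : E n →ₗ[ℝ] E n))
    (fun z hz => by simp [h.fderiv_gradient_of_mem_orthogonal z hz])
    (fun v z => by
      have := h.isSymmetric_fderiv_gradient v z
      simp only [LinearMap.neg_apply, inner_neg_left, inner_neg_right, this])
    (secondFundamentalForm Ω p) (fun X Y => by rw [h.form_eq]; simp)
  set b := EuclideanSpace.basisFun (Fin n) ℝ with hb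
  rw [h1, LinearMap.trace_eq_sum_inner _ b]
  refine Finset.sum_congr rfl fun i _ => ?_
  have h2 := b.sum_sq_norm_inner_left (fderiv ℝ (gradient ρ) p (b i))
  have h3 : inner ℝ (b i) ((fderiv ℝ (gradient ρ) p) (fderiv ℝ (gradient ρ) p (b i)))
      = ‖fderiv ℝ (gradient ρ) p (b i)‖ ^ 2 := by
    rw [← real_inner_self_eq_norm_sq]
    exact (h.isSymmetric_fderiv_gradient _ _).symm
  simp only [LinearMap.comp_apply, LinearMap.neg_apply, map_neg, neg_neg,
    ContinuousLinearMap.coe_coe]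
  rw [h3, ← h2]
  refine Finset.sum_congr rfl fun j _ => ?_
  rw [Real.norm_eq_abs, sq_abs, hb, h.inner_fderiv_gradient_single]

theorem formNormSq_traceFree_eq (h : IsNormalCoordinates Ω p y ρ) (hn : 2 ≤ n) :
    formNormSq (traceFreeSecondFundamentalForm Ω p)
      = formNormSq (secondFundamentalForm Ω p) - meanCurvature Ω p ^ 2 / ((n : ℝ) - 1) := by
  have hν : innerNormal Ω p ≠ 0 := by
    rw [← h.gradient_eq, ← norm_ne_zero_iff, h.norm_gradient.self_of_nhds]
    simp
  have : Fact (Module.finrank ℝ (E n) = (n - 1) + 1) := ⟨by simp; omega⟩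
  have hd : Module.finrank ℝ (tangentPlane Ω p) = n - 1 :=
    Submodule.finrank_orthogonal_span_singleton hν
  have hn1 : ((n : ℝ) - 1) ≠ 0 := by
    have : (2 : ℝ) ≤ n := by exact_mod_cast hn
    linarith
  rw [traceFreeSecondFundamentalForm, formNormSq_sub_smul_inner, hd, Nat.cast_sub (by omega)]
  change _ - 2 * _ * meanCurvature Ω p + _ = _
  push_cast
  field_simp
  ring

end IsNormalCoordinates

/-! ### The Laplacian of the distance -/

/-- The Laplacian, as a sum of second partial derivatives. -/
noncomputable def lap {n : ℕ} (u : E n → ℝ) (x : E n) : ℝ :=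
  ∑ i, partialDeriv i (partialDeriv i u) x

namespace IsNormalCoordinates

variable {n : ℕ} {Ω : Set (E n)} {p : E n} {y : E n → E n} {ρ : E n → ℝ}

theorem sum_partialDeriv_sq (h : IsNormalCoordinates Ω p y ρ) :
    ∀ᶠ x in 𝓝 p, ∑ i, partialDeriv i ρ x ^ 2 = 1 := by
  filter_upwards [h.norm_gradient] with x hx
  rw [← norm_gradient_sq, hx, one_pow]

theorem eventually_smooth (h : IsNormalCoordinates Ω p y ρ) (m : ℕ) :
    ∀ᶠ x in 𝓝 p, ContDiffAt ℝ m ρ x :=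
  (h.smooth_dist.of_le (natCast_le_infty m)).eventually (by simp)

theorem contDiffAt_partialDeriv (h : IsNormalCoordinates Ω p y ρ) (i : Fin n) :
    ContDiffAt ℝ ∞ (partialDeriv i ρ) p :=
  SigmaKRicci.contDiffAt_partialDeriv h.smooth_dist (by simp) i

theorem contDiffAt_partialDeriv₂ (h : IsNormalCoordinates Ω p y ρ) (i j : Fin n) :
    ContDiffAt ℝ ∞ (partialDeriv i (partialDeriv j ρ)) p :=
  SigmaKRicci.contDiffAt_partialDeriv (h.contDiffAt_partialDeriv j) (by simp) i

/-- The Hessian of the distance annihilates the normal. -/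
theorem sum_hessian_mul_partialDeriv (h : IsNormalCoordinates Ω p y ρ) (i : Fin n) :
    ∀ᶠ x in 𝓝 p, ∑ j, partialDeriv i (partialDeriv j ρ) x * partialDeriv j ρ x = 0 := by
  filter_upwards [h.sum_partialDeriv_sq.eventually_nhds, h.eventually_smooth 2] with x h1 h2
  have hd : ∀ j, DifferentiableAt ℝ (partialDeriv j ρ) x := fun j =>
    (SigmaKRicci.contDiffAt_partialDeriv (m' := 1) h2 le_rfl j).differentiableAt (by simp)
  have h3 : (fun z => ∑ j, partialDeriv j ρ z * partialDeriv j ρ z) =ᶠ[𝓝 x] fun _ => (1 : ℝ) := by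
    filter_upwards [h1] with z hz
    simpa [pow_two] using hz
  have h4 := (partialDeriv_congr h3 i).self_of_nhds
  rw [partialDeriv_sum (fun j _ => (hd j).fun_mul (hd j))] at h4
  simp only [partialDeriv_mul (hd _) (hd _)] at h4
  have h5 : partialDeriv i (fun _ : E n => (1 : ℝ)) x = 0 := by simp [partialDeriv]
  rw [h5] at h4
  have h6 : ∀ j, partialDeriv i (partialDeriv j ρ) x * partialDeriv j ρ x
      + partialDeriv j ρ x * partialDeriv i (partialDeriv j ρ) x
      = 2 * (partialDeriv i (partialDeriv j ρ) x * partialDeriv j ρ x) := fun j => by ring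
  simp only [h6, ← Finset.mul_sum] at h4
  linarith

/-- The Riccati equation for the mean curvature of parallel surfaces: `∂_ν Δρ = -|∇²ρ|²`. -/
theorem fderiv_lap_gradient (h : IsNormalCoordinates Ω p y ρ) :
    fderiv ℝ (lap ρ) p (gradient ρ p) = -∑ i, ∑ j, partialDeriv i (partialDeriv j ρ) p ^ 2 := by
  have hd : ∀ j, DifferentiableAt ℝ (partialDeriv j ρ) p := fun j =>
    (h.contDiffAt_partialDeriv j).differentiableAt (by simp)
  have hd2 : ∀ i j, DifferentiableAt ℝ (partialDeriv i (partialDeriv j ρ)) p := fun i j =>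
    (h.contDiffAt_partialDeriv₂ i j).differentiableAt (by simp)
  have h1 : ∀ i, ∑ j, (partialDeriv j (partialDeriv i (partialDeriv i ρ)) p * partialDeriv j ρ p
      + partialDeriv i (partialDeriv j ρ) p ^ 2) = 0 := by
    intro i
    have h2 : (fun z => ∑ j, partialDeriv i (partialDeriv j ρ) z * partialDeriv j ρ z)
        =ᶠ[𝓝 p] fun _ => (0 : ℝ) := h.sum_hessian_mul_partialDeriv i
    have h4 := (partialDeriv_congr h2 i).self_of_nhds
    rw [partialDeriv_sum (fun j _ => (hd2 i j).fun_mul (hd j))] at h4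
    have h5 : partialDeriv i (fun _ : E n => (0 : ℝ)) p = 0 := by simp [partialDeriv]
    rw [h5] at h4
    rw [← h4]
    refine Finset.sum_congr rfl fun j _ => ?_
    have h6 : partialDeriv i (partialDeriv j ρ) =ᶠ[𝓝 p] partialDeriv j (partialDeriv i ρ) := by
      filter_upwards [h.eventually_smooth 2] with z hz
      exact partialDeriv_comm hz i j
    have h7 : ContDiffAt ℝ 2 (partialDeriv i ρ) p :=
      (h.contDiffAt_partialDeriv i).of_le (natCast_le_infty 2)
    rw [partialDeriv_mul (hd2 i j) (hd j), (partialDeriv_congr h6 i).self_of_nhds,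
      partialDeriv_comm h7 i j]
    ring
  have h8 : ∀ j, partialDeriv j (lap ρ) p
      = ∑ i, partialDeriv j (partialDeriv i (partialDeriv i ρ)) p := fun j =>
    partialDeriv_sum (fun i _ => hd2 i i) j
  rw [fderiv_apply_eq_sum]
  simp only [gradient_apply, h8, Finset.mul_sum]
  rw [Finset.sum_comm, ← Finset.sum_neg_distrib]
  refine Finset.sum_congr rfl fun i _ => ?_
  have := h1 i
  rw [Finset.sum_add_distrib] at this
  rw [← eq_neg_iff_add_eq_zero.mpr this]
  exact Finset.sum_congr rfl fun j _ => mul_comm _ _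

theorem contDiffAt_lap (h : IsNormalCoordinates Ω p y ρ) : ContDiffAt ℝ ∞ (lap ρ) p :=
  ContDiffAt.sum fun i _ => h.contDiffAt_partialDeriv₂ i i

/-- Near `p` the mean curvature of the boundary is `-Δρ`: the distance functions of normal
coordinates at different boundary points agree inside `Ω`. -/
theorem eventually_meanCurvature_eq (h : IsNormalCoordinates Ω p y ρ)
    (hΩ : IsBoundedSmoothDomain Ω) :
    ∀ᶠ q in 𝓝 p, q ∈ frontier Ω → meanCurvature Ω q = -lap ρ q := by
  have hev := eventually_nhdsWithin_iff.mp h.eventually_eq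
  have hcont : ∀ᶠ q in 𝓝 p, ContinuousAt (lap ρ) q :=
    ((h.contDiffAt_lap.of_le (m := 1) (by simp)).eventually (by simp)).mono
      fun q hq => hq.continuousAt
  filter_upwards [hev.eventually_nhds, hcont] with q h1 h2 hq
  obtain ⟨y', ρ', h'⟩ := exists_isNormalCoordinates hΩ hq
  have h3 : ∀ᶠ x in 𝓝 q, x ∈ Ω → ρ x = ρ' x := by
    filter_upwards [h1, eventually_nhdsWithin_iff.mp h'.eventually_eq] with x h4 h5 hx
    rw [← (h4 hx).2.1, ← (h5 hx).2.1]
  have h6 : lap ρ =ᶠ[𝓝[Ω] q] lap ρ' := by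
    filter_upwards [mem_nhdsWithin_of_mem_nhds h3.eventually_nhds, self_mem_nhdsWithin]
      with x h4 hx
    have h5 : ρ =ᶠ[𝓝 x] ρ' := by
      filter_upwards [h4, hΩ.isOpen.mem_nhds hx] with z hz hz'
      exact hz hz'
    simp only [lap]
    exact Finset.sum_congr rfl fun i _ =>
      (partialDeriv_congr (partialDeriv_congr h5 i) i).self_of_nhds
  have : (𝓝[Ω] q).NeBot := mem_closure_iff_nhdsWithin_neBot.mp hq.1
  have h7 : lap ρ q = lap ρ' q :=
    tendsto_nhds_unique ((h2.tendsto.mono_left nhdsWithin_le_nhds).congr' h6)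
      (h'.contDiffAt_lap.continuousAt.tendsto.mono_left nhdsWithin_le_nhds)
  rw [h'.meanCurvature_eq, h7, lap]

theorem tendsto_dist (h : IsNormalCoordinates Ω p y ρ) : Tendsto ρ (𝓝[Ω] p) (𝓝[>] 0) := by
  refine tendsto_nhdsWithin_iff.mpr ⟨?_, h.eventually_eq.mono fun x hx => hx.1⟩
  have := h.smooth_dist.continuousAt.tendsto
  rw [h.dist_self] at this
  exact this.mono_left nhdsWithin_le_nhds

theorem tendsto_foot (h : IsNormalCoordinates Ω p y ρ) : Tendsto y (𝓝 p) (𝓝 p) := by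
  have := h.smooth_foot.continuousAt.tendsto
  rwa [h.foot_self] at this

/-- The difference quotient along normal segments, whose foot points vary, tends to the normal
derivative, because `f` is strictly differentiable. -/
theorem tendsto_sub_foot_div (h : IsNormalCoordinates Ω p y ρ) {f : E n → ℝ}
    (hf : ContDiffAt ℝ ∞ f p) :
    Tendsto (fun x => (f x - f (y x)) / ρ x) (𝓝[Ω] p) (𝓝 (fderiv ℝ f p (gradient ρ p))) := by
  have hs : HasStrictFDerivAt f (fderiv ℝ f p) p := hf.hasStrictFDerivAt (by simp)
  have hpair : Tendsto (fun x : E n => (x, y x)) (𝓝[Ω] p) (𝓝 (p, p)) :=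
    (tendsto_id.prodMk_nhds h.tendsto_foot).mono_left nhdsWithin_le_nhds
  have h1 := hs.isLittleO.comp_tendsto hpair
  have h2 : (fun x => f x - f (y x) - ρ x * fderiv ℝ f p (gradient ρ x)) =o[𝓝[Ω] p] ρ := by
    refine (h1.congr' ?_ EventuallyEq.rfl).trans_isBigO ?_
    · filter_upwards [mem_nhdsWithin_of_mem_nhds h.foot_add] with x hx
      have : x - y x = ρ x • gradient ρ x := sub_eq_iff_eq_add'.mpr hx.symm
      simp only [Function.comp_apply, this, map_smul, smul_eq_mul]
    · refine Asymptotics.IsBigO.of_bound 1 ?_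
      filter_upwards [mem_nhdsWithin_of_mem_nhds h.foot_add,
        mem_nhdsWithin_of_mem_nhds h.norm_gradient] with x hx hx'
      have : x - y x = ρ x • gradient ρ x := sub_eq_iff_eq_add'.mpr hx.symm
      simp only [Function.comp_apply, this, norm_smul, hx', mul_one, one_mul, le_refl]
  have h3 := h2.tendsto_div_nhds_zero
  have hg : ContinuousAt (gradient ρ) p :=
    (contDiffAt_gradient (m' := 1) h.smooth_two le_rfl).continuousAt
  have h4 : Tendsto (fun x => fderiv ℝ f p (gradient ρ x)) (𝓝[Ω] p)
      (𝓝 (fderiv ℝ f p (gradient ρ p))) :=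
    (((fderiv ℝ f p).continuous.tendsto _).comp hg.tendsto).mono_left nhdsWithin_le_nhds
  have h5 := h3.add h4
  rw [zero_add] at h5
  refine h5.congr' ?_
  filter_upwards [h.eventually_eq] with x hx
  have := hx.1.ne'
  field_simp
  ring

theorem contDiffAt_comp_foot (h : IsNormalCoordinates Ω p y ρ) (hp : p ∈ frontier Ω)
    {c : E n → ℝ} (hc : ContDiffOn ℝ ∞ c (frontier Ω)) : ContDiffAt ℝ ∞ (c ∘ y) p := by
  have hcy : ContDiffWithinAt ℝ ∞ c (frontier Ω) (y p) := by
    rw [h.foot_self]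
    exact hc p hp
  exact (hcy.comp p h.smooth_foot.contDiffWithinAt
    (s := {x | y x ∈ frontier Ω}) (fun x hx => hx)).contDiffAt h.foot_mem

/-- A function of the foot point has vanishing normal derivative. -/
theorem sum_partialDeriv_comp_foot (h : IsNormalCoordinates Ω p y ρ) (hp : p ∈ frontier Ω)
    {c : E n → ℝ} (hc : ContDiffOn ℝ ∞ c (frontier Ω)) :
    ∑ i, partialDeriv i (c ∘ y) p * partialDeriv i ρ p = 0 := by
  have h1 : ∑ i, partialDeriv i (c ∘ y) p * partialDeriv i ρ p
      = fderiv ℝ (c ∘ y) p (gradient ρ p) := by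
    rw [fderiv_apply_eq_sum]
    exact Finset.sum_congr rfl fun i _ => by rw [gradient_apply, mul_comm]
  have hd : HasFDerivAt (c ∘ y) (fderiv ℝ (c ∘ y) p) (p + (0 : ℝ) • gradient ρ p) := by
    rw [zero_smul, add_zero]
    exact ((h.contDiffAt_comp_foot hp hc).differentiableAt (by simp)).hasFDerivAt
  have hl : HasDerivAt (fun t : ℝ => p + t • gradient ρ p) (gradient ρ p) 0 := by
    simpa using ((hasDerivAt_id (0 : ℝ)).smul_const (gradient ρ p)).const_add p
  have h2 := (hd.comp_hasDerivAt (0 : ℝ) hl).deriv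
  have h3 : ((c ∘ y) ∘ fun t : ℝ => p + t • gradient ρ p) =ᶠ[𝓝 0] fun _ => c p := by
    filter_upwards [h.foot_line] with t ht
    simp [ht]
  rw [h1, ← h2, h3.deriv_eq]
  simp

end IsNormalCoordinates

/-! ### Functions of the distance and remainder terms -/

section Calculus

variable {n : ℕ} {u C : E n → ℝ} {x : E n} {f f' : ℝ → ℝ}

theorem partialDeriv_mul_comp (hC : DifferentiableAt ℝ C x) (hu : DifferentiableAt ℝ u x)
    (hf : HasDerivAt f (f' (u x)) (u x)) (i : Fin n) :
    partialDeriv i (fun z => C z * f (u z)) x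
      = partialDeriv i C x * f (u x) + C x * (f' (u x) * partialDeriv i u x) := by
  rw [partialDeriv_mul (w := fun z => f (u z)) hC (hf.differentiableAt.comp x hu),
    partialDeriv_comp hf hu]

/-- The second derivatives of `C f(u)`, for a function `f` of one variable. -/
theorem partialDeriv₂_mul_comp (hC : ContDiffAt ℝ 2 C x) (hu : ContDiffAt ℝ 2 u x)
    (hf : ∀ᶠ t in 𝓝 (u x), HasDerivAt f (f' t) t) {f'' : ℝ} (hf' : HasDerivAt f' f'' (u x))
    (i j : Fin n) :
    partialDeriv i (partialDeriv j fun z => C z * f (u z)) x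
      = partialDeriv i (partialDeriv j C) x * f (u x)
        + partialDeriv j C x * (f' (u x) * partialDeriv i u x)
        + partialDeriv i C x * (f' (u x) * partialDeriv j u x)
        + C x * (f'' * partialDeriv i u x * partialDeriv j u x
          + f' (u x) * partialDeriv i (partialDeriv j u) x) := by
  have hCd : DifferentiableAt ℝ C x := hC.differentiableAt (by simp)
  have hud : DifferentiableAt ℝ u x := hu.differentiableAt (by simp)
  have hjC : DifferentiableAt ℝ (partialDeriv j C) x :=
    (contDiffAt_partialDeriv (m' := 1) hC le_rfl j).differentiableAt (by simp)
  have hju : DifferentiableAt ℝ (partialDeriv j u) x :=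
    (contDiffAt_partialDeriv (m' := 1) hu le_rfl j).differentiableAt (by simp)
  have hfd := hf.self_of_nhds
  have h1 : partialDeriv j (fun z => C z * f (u z)) =ᶠ[𝓝 x]
      fun z => partialDeriv j C z * f (u z) + C z * (f' (u z) * partialDeriv j u z) := by
    filter_upwards [hC.eventually (by simp), hu.eventually (by simp),
      hu.continuousAt.eventually hf] with z h1 h2 h3
    exact partialDeriv_mul_comp (h1.differentiableAt (by simp)) (h2.differentiableAt (by simp)) h3 j
  have hfu : DifferentiableAt ℝ (fun z => f (u z)) x := hfd.differentiableAt.comp x hud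
  have hfu' : DifferentiableAt ℝ (fun z => f' (u z)) x := hf'.differentiableAt.comp x hud
  rw [(partialDeriv_congr h1 i).self_of_nhds,
    partialDeriv_add (hjC.fun_mul hfu) (hCd.fun_mul (hfu'.fun_mul hju)),
    partialDeriv_mul hjC hfu, partialDeriv_mul hCd (hfu'.fun_mul hju), partialDeriv_mul hfu' hju,
    partialDeriv_comp hfd hud, partialDeriv_comp hf' hud]
  ring

end Calculus

/-- A remainder `r = o(d²)` whose first and second derivatives are `o(d)` and `o(1)`. -/
structure IsRemainder {n : ℕ} (l : Filter (E n)) (ρ r : E n → ℝ) : Prop where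
  smooth : ∀ᶠ x in l, ContDiffAt ℝ 2 r x
  tendsto_div_sq : Tendsto (fun x => r x / ρ x ^ 2) l (𝓝 0)
  tendsto_partialDeriv_div : ∀ i, Tendsto (fun x => partialDeriv i r x / ρ x) l (𝓝 0)
  tendsto_partialDeriv₂ : ∀ i j, Tendsto (partialDeriv i (partialDeriv j r)) l (𝓝 0)

section Remainder

variable {n : ℕ} {l : Filter (E n)} {ρ r s : E n → ℝ}

theorem IsRemainder.add (hr : IsRemainder l ρ r) (hs : IsRemainder l ρ s) :
    IsRemainder l ρ (fun x => r x + s x) where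
  smooth := by
    filter_upwards [hr.smooth, hs.smooth] with x h1 h2
    exact h1.add h2
  tendsto_div_sq := by
    simpa [add_div] using hr.tendsto_div_sq.add hs.tendsto_div_sq
  tendsto_partialDeriv_div i := by
    have h := (hr.tendsto_partialDeriv_div i).add (hs.tendsto_partialDeriv_div i)
    rw [add_zero] at h
    refine h.congr' ?_
    filter_upwards [hr.smooth, hs.smooth] with x h1 h2
    rw [partialDeriv_add (h1.differentiableAt (by simp)) (h2.differentiableAt (by simp)), add_div]
  tendsto_partialDeriv₂ i j := by
    have h := (hr.tendsto_partialDeriv₂ i j).add (hs.tendsto_partialDeriv₂ i j)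
    rw [add_zero] at h
    refine h.congr' ?_
    filter_upwards [hr.smooth, hs.smooth] with x h1 h2
    have h3 : partialDeriv j (fun z => r z + s z) =ᶠ[𝓝 x]
        fun z => partialDeriv j r z + partialDeriv j s z := by
      filter_upwards [h1.eventually (by simp), h2.eventually (by simp)] with z h4 h5
      exact partialDeriv_add (h4.differentiableAt (by simp)) (h5.differentiableAt (by simp)) j
    rw [(partialDeriv_congr h3 i).self_of_nhds, partialDeriv_add
      ((contDiffAt_partialDeriv (m' := 1) h1 le_rfl j).differentiableAt (by simp))
      ((contDiffAt_partialDeriv (m' := 1) h2 le_rfl j).differentiableAt (by simp))]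

theorem partialDeriv_const (i : Fin n) (a : ℝ) :
    partialDeriv i (fun _ : E n => a) = fun _ => 0 := by
  funext x
  simp [partialDeriv]

theorem IsRemainder.zero : IsRemainder l ρ (fun _ => 0) where
  smooth := Eventually.of_forall fun x => contDiffAt_const
  tendsto_div_sq := by
    simpa using tendsto_const_nhds
  tendsto_partialDeriv_div i := by
    simpa [partialDeriv_const] using tendsto_const_nhds
  tendsto_partialDeriv₂ i j := by
    simpa [partialDeriv_const] using tendsto_const_nhds

theorem IsRemainder.sum {ι : Type*} (t : Finset ι) {f : ι → E n → ℝ}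
    (hf : ∀ a ∈ t, IsRemainder l ρ (f a)) : IsRemainder l ρ (fun x => ∑ a ∈ t, f a x) := by
  classical
  induction t using Finset.induction_on with
  | empty => simpa using IsRemainder.zero
  | insert a t ha ih =>
    simp only [Finset.sum_insert ha]
    exact (hf a (Finset.mem_insert_self a t)).add
      (ih fun b hb => hf b (Finset.mem_insert_of_mem hb))

end Remainder

section RemainderTerms

variable {n : ℕ} {Ω : Set (E n)} {p : E n} {y : E n → E n} {ρ C : E n → ℝ}

/-- The product of a smooth function and `f(ρ)` is a remainder if `f = o(t²)`, `f' = o(t)` and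
`f'' = o(1)` as `t → 0⁺`. -/
theorem IsNormalCoordinates.isRemainder_mul_comp (h : IsNormalCoordinates Ω p y ρ)
    (hC : ContDiffAt ℝ ∞ C p) {f f' f'' : ℝ → ℝ}
    (hs : ∀ t, 0 < t → ContDiffAt ℝ 2 f t)
    (hf : ∀ t, 0 < t → HasDerivAt f (f' t) t) (hf' : ∀ t, 0 < t → HasDerivAt f' (f'' t) t)
    (h0 : Tendsto (fun t => f t / t ^ 2) (𝓝[>] 0) (𝓝 0))
    (h1 : Tendsto (fun t => f' t / t) (𝓝[>] 0) (𝓝 0))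
    (h2 : Tendsto f'' (𝓝[>] 0) (𝓝 0)) :
    IsRemainder (𝓝[Ω] p) ρ (fun x => C x * f (ρ x)) := by
  have hpos : ∀ᶠ x in 𝓝[Ω] p, 0 < ρ x := h.eventually_eq.mono fun x hx => hx.1
  have hC2 : ∀ᶠ x in 𝓝[Ω] p, ContDiffAt ℝ 2 C x :=
    mem_nhdsWithin_of_mem_nhds ((hC.of_le (natCast_le_infty 2)).eventually (by simp))
  have hρ2 : ∀ᶠ x in 𝓝[Ω] p, ContDiffAt ℝ 2 ρ x :=
    mem_nhdsWithin_of_mem_nhds (h.eventually_smooth 2)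
  have hρ := h.tendsto_dist
  have hρ0 : Tendsto ρ (𝓝[Ω] p) (𝓝 0) := hρ.mono_right nhdsWithin_le_nhds
  have t0 : Tendsto (fun x => f (ρ x) / ρ x ^ 2) (𝓝[Ω] p) (𝓝 0) := h0.comp hρ
  have t1 : Tendsto (fun x => f' (ρ x) / ρ x) (𝓝[Ω] p) (𝓝 0) := h1.comp hρ
  have t2 : Tendsto (fun x => f'' (ρ x)) (𝓝[Ω] p) (𝓝 0) := h2.comp hρ
  have t0' : Tendsto (fun x => f (ρ x) / ρ x) (𝓝[Ω] p) (𝓝 0) := by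
    have := t0.mul hρ0
    rw [zero_mul] at this
    refine this.congr' ?_
    filter_upwards [hpos] with x hx
    field_simp
  have t0'' : Tendsto (fun x => f (ρ x)) (𝓝[Ω] p) (𝓝 0) := by
    have := t0'.mul hρ0
    rw [zero_mul] at this
    refine this.congr' ?_
    filter_upwards [hpos] with x hx
    field_simp
  have t1' : Tendsto (fun x => f' (ρ x)) (𝓝[Ω] p) (𝓝 0) := by
    have := t1.mul hρ0
    rw [zero_mul] at this
    refine this.congr' ?_
    filter_upwards [hpos] with x hx
    field_simp
  have cC : Tendsto C (𝓝[Ω] p) (𝓝 (C p)) := hC.continuousAt.tendsto.mono_left nhdsWithin_le_nhds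
  have dC : ∀ i, ContDiffAt ℝ ∞ (partialDeriv i C) p := fun i =>
    SigmaKRicci.contDiffAt_partialDeriv hC (by simp) i
  have cdC : ∀ i, Tendsto (partialDeriv i C) (𝓝[Ω] p) (𝓝 (partialDeriv i C p)) := fun i =>
    (dC i).continuousAt.tendsto.mono_left nhdsWithin_le_nhds
  have cddC : ∀ i j, Tendsto (partialDeriv i (partialDeriv j C)) (𝓝[Ω] p)
      (𝓝 (partialDeriv i (partialDeriv j C) p)) := fun i j =>
    (SigmaKRicci.contDiffAt_partialDeriv (m' := ∞) (dC j) (by simp)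
      i).continuousAt.tendsto.mono_left nhdsWithin_le_nhds
  have cdρ : ∀ i, Tendsto (partialDeriv i ρ) (𝓝[Ω] p) (𝓝 (partialDeriv i ρ p)) := fun i =>
    (h.contDiffAt_partialDeriv i).continuousAt.tendsto.mono_left nhdsWithin_le_nhds
  have cddρ : ∀ i j, Tendsto (partialDeriv i (partialDeriv j ρ)) (𝓝[Ω] p)
      (𝓝 (partialDeriv i (partialDeriv j ρ) p)) := fun i j =>
    (h.contDiffAt_partialDeriv₂ i j).continuousAt.tendsto.mono_left nhdsWithin_le_nhds
  refine ⟨?_, ?_, fun i => ?_, fun i j => ?_⟩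
  · filter_upwards [hpos, hC2, hρ2] with x hx h3 h4
    exact h3.mul ((hs _ hx).comp x h4)
  · simpa [mul_div_assoc] using cC.mul t0
  · have := ((cdC i).mul t0').add (cC.mul (t1.mul (cdρ i)))
    simp only [mul_zero, zero_mul, add_zero] at this
    refine this.congr' ?_
    filter_upwards [hpos, hC2, hρ2] with x hx h3 h4
    rw [partialDeriv_mul_comp (h3.differentiableAt (by simp)) (h4.differentiableAt (by simp))
      (hf _ hx)]
    field_simp
  · have := ((((cddC i j).mul t0'').add ((cdC j).mul (t1'.mul (cdρ i)))).add
      ((cdC i).mul (t1'.mul (cdρ j)))).add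
      (cC.mul (((t2.mul (cdρ i)).mul (cdρ j)).add (t1'.mul (cddρ i j))))
    simp only [mul_zero, zero_mul, add_zero] at this
    refine this.congr' ?_
    filter_upwards [hpos, hC2, hρ2] with x hx h3 h4
    have hev : ∀ᶠ t in 𝓝 (ρ x), HasDerivAt f (f' t) t := by
      filter_upwards [lt_mem_nhds hx] with t ht
      exact hf t ht
    exact (partialDeriv₂_mul_comp h3 h4 hev (hf' _ hx) i j).symm

theorem IsNormalCoordinates.isRemainder_mul_pow (h : IsNormalCoordinates Ω p y ρ)
    (hC : ContDiffAt ℝ ∞ C p) (m : ℕ) :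
    IsRemainder (𝓝[Ω] p) ρ (fun x => C x * ρ x ^ (m + 3)) := by
  have hid : ∀ k : ℕ, Tendsto (fun t : ℝ => t ^ (k + 1)) (𝓝[>] 0) (𝓝 0) := fun k => by
    have : Tendsto (fun t : ℝ => t ^ (k + 1)) (𝓝 0) (𝓝 (0 ^ (k + 1))) :=
      (continuous_pow (k + 1)).tendsto 0
    simpa using this.mono_left nhdsWithin_le_nhds
  have h1 := (hid m).const_mul ((m : ℝ) + 3)
  have h2 := (hid m).const_mul (((m : ℝ) + 3) * (m + 2))
  rw [mul_zero] at h1 h2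
  refine h.isRemainder_mul_comp hC (f := fun t => t ^ (m + 3))
    (f' := fun t => ((m : ℝ) + 3) * t ^ (m + 2))
    (f'' := fun t => ((m : ℝ) + 3) * (m + 2) * t ^ (m + 1))
    (fun t _ => contDiffAt_id.pow _) (fun t _ => ?_) (fun t _ => ?_) ?_ ?_ h2
  · simpa using hasDerivAt_pow (m + 3) t
  · have := (hasDerivAt_pow (m + 2) t).const_mul ((m : ℝ) + 3)
    simpa [mul_assoc] using this
  · refine (hid m).congr' ?_
    filter_upwards [self_mem_nhdsWithin] with t ht
    have : t ≠ 0 := ne_of_gt ht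
    field_simp
    ring
  · refine h1.congr' ?_
    filter_upwards [self_mem_nhdsWithin] with t ht
    have : t ≠ 0 := ne_of_gt ht
    field_simp
    ring

theorem IsNormalCoordinates.isRemainder_mul_pow_mul_log (h : IsNormalCoordinates Ω p y ρ)
    (hC : ContDiffAt ℝ ∞ C p) (m : ℕ) :
    IsRemainder (𝓝[Ω] p) ρ (fun x => C x * (ρ x ^ (m + 3) * Real.log (ρ x))) := by
  have hid : ∀ k : ℕ, Tendsto (fun t : ℝ => t ^ (k + 1)) (𝓝[>] 0) (𝓝 0) := fun k => by
    have : Tendsto (fun t : ℝ => t ^ (k + 1)) (𝓝 0) (𝓝 (0 ^ (k + 1))) :=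
      (continuous_pow (k + 1)).tendsto 0
    simpa using this.mono_left nhdsWithin_le_nhds
  have hlog : Tendsto (fun t : ℝ => t ^ (m + 1) * Real.log t) (𝓝[>] 0) (𝓝 0) := by
    have h1 : Tendsto (fun t : ℝ => Real.log t * t) (𝓝[>] 0) (𝓝 0) := by
      simpa only [Real.rpow_one] using tendsto_log_mul_rpow_nhdsGT_zero zero_lt_one
    have h2 : Tendsto (fun t : ℝ => t ^ m) (𝓝[>] 0) (𝓝 (0 ^ m)) :=
      ((continuous_pow m).tendsto 0).mono_left nhdsWithin_le_nhds
    have h3 := h2.mul h1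
    rw [mul_zero] at h3
    refine h3.congr fun t => ?_
    ring
  have h1 := (hlog.const_mul ((m : ℝ) + 3)).add (hid m)
  have h2 := (hlog.const_mul (((m : ℝ) + 3) * (m + 2))).add ((hid m).const_mul (2 * (m : ℝ) + 5))
  rw [mul_zero, add_zero] at h1
  rw [mul_zero, mul_zero, add_zero] at h2
  have hd : ∀ (k : ℕ) (t : ℝ), 0 < t → HasDerivAt (fun t => t ^ (k + 1) * Real.log t)
      ((k + 1) * t ^ k * Real.log t + t ^ k) t := by
    intro k t ht
    refine ((hasDerivAt_pow (k + 1) t).fun_mul (Real.hasDerivAt_log ht.ne')).congr_deriv ?_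
    have h3 : t ^ (k + 1) * t⁻¹ = t ^ k := by
      rw [pow_succ, mul_assoc, mul_inv_cancel₀ ht.ne', mul_one]
    rw [h3]
    push_cast
    simp
  refine h.isRemainder_mul_comp hC (f := fun t => t ^ (m + 3) * Real.log t)
    (f' := fun t => ((m : ℝ) + 3) * (t ^ (m + 2) * Real.log t) + t ^ (m + 2))
    (f'' := fun t => ((m : ℝ) + 3) * (m + 2) * (t ^ (m + 1) * Real.log t)
      + (2 * (m : ℝ) + 5) * t ^ (m + 1))
    (fun t ht => (contDiffAt_id.pow _).mul (Real.contDiffAt_log.mpr ht.ne'))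
    (fun t ht => ?_) (fun t ht => ?_) ?_ ?_ h2
  · refine (hd (m + 2) t ht).congr_deriv ?_
    push_cast
    ring
  · refine (((hd (m + 1) t ht).const_mul ((m : ℝ) + 3)).fun_add
      (hasDerivAt_pow (m + 2) t)).congr_deriv ?_
    push_cast
    ring
  · refine hlog.congr' ?_
    filter_upwards [self_mem_nhdsWithin] with t ht
    have : t ≠ 0 := ne_of_gt ht
    field_simp
    ring
  · refine h1.congr' ?_
    filter_upwards [self_mem_nhdsWithin] with t ht
    have : t ≠ 0 := ne_of_gt ht
    field_simp
    ring

end RemainderTerms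

/-! ### The rescaled matrix -/

/-- The vector of first partial derivatives. -/
noncomputable def gradVec {n : ℕ} (u : E n → ℝ) (x : E n) : Fin n → ℝ :=
  fun i => partialDeriv i u x

/-- The Hessian matrix. -/
noncomputable def hessMat {n : ℕ} (u : E n → ℝ) (x : E n) : Matrix (Fin n) (Fin n) ℝ :=
  Matrix.of fun i j => partialDeriv i (partialDeriv j u) x

/-- The matrix `Y` in `d² A(-log d + w) = (n - 1) I + d Y`, as a function of `d`, `a = ∇d`,
`b = ∇w`, `S = ∇²d` and `T = ∇²w`. -/
noncomputable def rescaledMatrix {n : ℕ} (d : ℝ) (a b : Fin n → ℝ)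
    (S T : Matrix (Fin n) (Fin n) ℝ) : Matrix (Fin n) (Fin n) ℝ :=
  -((n : ℝ) - 2) • S - S.trace • (1 : Matrix (Fin n) (Fin n) ℝ)
    - (2 * ((n : ℝ) - 2) * (a ⬝ᵥ b)) • (1 : Matrix (Fin n) (Fin n) ℝ)
    + ((n : ℝ) - 2) • (Matrix.vecMulVec a b + Matrix.vecMulVec b a)
    + d • (((n : ℝ) - 2) • T + T.trace • (1 : Matrix (Fin n) (Fin n) ℝ)
      + ((n : ℝ) - 2) • ((b ⬝ᵥ b) • (1 : Matrix (Fin n) (Fin n) ℝ) - Matrix.vecMulVec b b))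

section Rescaled

variable {n : ℕ}

theorem isSymm_rescaledMatrix (d : ℝ) (a b : Fin n → ℝ) {S T : Matrix (Fin n) (Fin n) ℝ}
    (hS : S.IsSymm) (hT : T.IsSymm) : (rescaledMatrix d a b S T).IsSymm := by
  ext i j
  have h1 : S j i = S i j := hS.apply i j
  have h2 : T j i = T i j := hT.apply i j
  have h3 : (1 : Matrix (Fin n) (Fin n) ℝ) j i = (1 : Matrix (Fin n) (Fin n) ℝ) i j :=
    Matrix.isSymm_one.apply i j
  simp only [rescaledMatrix, Matrix.transpose_apply, Matrix.add_apply, Matrix.sub_apply,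
    Matrix.smul_apply, Matrix.vecMulVec_apply, smul_eq_mul, h1, h2, h3]
  ring

theorem tendsto_rescaledMatrix {α : Type*} {l : Filter α} {d : α → ℝ} {a b : α → Fin n → ℝ}
    {S T : α → Matrix (Fin n) (Fin n) ℝ} {d₀ : ℝ} {a₀ b₀ : Fin n → ℝ}
    {S₀ T₀ : Matrix (Fin n) (Fin n) ℝ} (hd : Tendsto d l (𝓝 d₀)) (ha : Tendsto a l (𝓝 a₀))
    (hb : Tendsto b l (𝓝 b₀)) (hS : Tendsto S l (𝓝 S₀)) (hT : Tendsto T l (𝓝 T₀)) :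
    Tendsto (fun x => rescaledMatrix (d x) (a x) (b x) (S x) (T x)) l
      (𝓝 (rescaledMatrix d₀ a₀ b₀ S₀ T₀)) := by
  have tr : ∀ {M : α → Matrix (Fin n) (Fin n) ℝ} {M₀ : Matrix (Fin n) (Fin n) ℝ},
      Tendsto M l (𝓝 M₀) → Tendsto (fun x => (M x).trace) l (𝓝 M₀.trace) := fun {M M₀} hM =>
    ((continuous_id.matrix_trace).tendsto M₀).comp hM
  have dot : ∀ {v w : α → Fin n → ℝ} {v₀ w₀ : Fin n → ℝ}, Tendsto v l (𝓝 v₀) → Tendsto w l (𝓝 w₀) →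
      Tendsto (fun x => v x ⬝ᵥ w x) l (𝓝 (v₀ ⬝ᵥ w₀)) := fun {v w v₀ w₀} hv hw =>
    ((continuous_fst.dotProduct continuous_snd).tendsto (v₀, w₀)).comp (hv.prodMk_nhds hw)
  have vec : ∀ {v w : α → Fin n → ℝ} {v₀ w₀ : Fin n → ℝ}, Tendsto v l (𝓝 v₀) → Tendsto w l (𝓝 w₀) →
      Tendsto (fun x => Matrix.vecMulVec (v x) (w x)) l (𝓝 (Matrix.vecMulVec v₀ w₀)) :=
    fun {v w v₀ w₀} hv hw =>
      ((continuous_fst.matrix_vecMulVec continuous_snd).tendsto (v₀, w₀)).comp (hv.prodMk_nhds hw)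
  exact ((((hS.const_smul _).sub ((tr hS).smul_const _)).sub
    (((dot ha hb).const_mul _).smul_const _)).add (((vec ha hb).add (vec hb ha)).const_smul _)).add
    (hd.smul (((hT.const_smul _).add ((tr hT).smul_const _)).add
      ((((dot hb hb).smul_const _).sub (vec hb hb)).const_smul _)))

theorem trace_rescaledMatrix (d : ℝ) (a b : Fin n → ℝ) (S T : Matrix (Fin n) (Fin n) ℝ) :
    (rescaledMatrix d a b S T).trace
      = ((n : ℝ) - 1) * (-2 * S.trace - 2 * ((n : ℝ) - 2) * (a ⬝ᵥ b)
        + d * (2 * T.trace + ((n : ℝ) - 2) * (b ⬝ᵥ b))) := by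
  simp only [rescaledMatrix, Matrix.trace_add, Matrix.trace_sub, Matrix.trace_smul,
    Matrix.trace_one, Matrix.trace_vecMulVec, smul_eq_mul, Fintype.card_fin, dotProduct_comm b a]
  ring

/-- At `d = 0` and for `∇w` normal to the boundary, the square of the rescaled matrix has a trace
determined by the trace `H` and the squared norm of the Hessian of the distance. -/
theorem trace_rescaledMatrix_mul_self (a : Fin n → ℝ) (S T : Matrix (Fin n) (Fin n) ℝ) (c : ℝ)
    (ha : a ⬝ᵥ a = 1) (hSa : S.mulVec a = 0) :
    (rescaledMatrix 0 a (c • a) S T * rescaledMatrix 0 a (c • a) S T).trace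
      = ((n : ℝ) - 2) ^ 2 * (S * S).trace
        + n * (S.trace + 2 * ((n : ℝ) - 2) * c) ^ 2 + (2 * ((n : ℝ) - 2) * c) ^ 2
        + 2 * ((n : ℝ) - 2) * (S.trace + 2 * ((n : ℝ) - 2) * c) * S.trace
        - 2 * (S.trace + 2 * ((n : ℝ) - 2) * c) * (2 * ((n : ℝ) - 2) * c) := by
  set Q := Matrix.vecMulVec a a with hQ
  have e : rescaledMatrix 0 a (c • a) S T = (-((n : ℝ) - 2)) • S
      + (-(S.trace + 2 * ((n : ℝ) - 2) * c)) • (1 : Matrix (Fin n) (Fin n) ℝ)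
      + (2 * ((n : ℝ) - 2) * c) • Q := by
    ext i j
    simp [rescaledMatrix, hQ, Matrix.vecMulVec_apply, ha]
    ring
  have hSQ : S * Q = 0 := by
    rw [hQ, Matrix.mul_vecMulVec, hSa, Matrix.zero_vecMulVec]
  have hQS : (Q * S).trace = 0 := by rw [Matrix.trace_mul_comm, hSQ, Matrix.trace_zero]
  have hQQ : Q * Q = Q := by
    rw [hQ, Matrix.vecMulVec_mul_vecMulVec, ha, one_smul]
  have hQt : Q.trace = 1 := by rw [hQ, Matrix.trace_vecMulVec, ha]
  rw [e]
  simp only [Matrix.add_mul, Matrix.mul_add, Matrix.smul_mul, Matrix.mul_smul, Matrix.one_mul,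
    Matrix.mul_one, hSQ, hQQ, Matrix.trace_add, Matrix.trace_smul, hQS, hQt, Matrix.trace_one,
    smul_eq_mul, Fintype.card_fin, Matrix.trace_zero, smul_zero]
  ring

variable {Ω : Set (E n)} {u ρ w : E n → ℝ} {x : E n}

theorem isSymm_hessMat (hu : ContDiffAt ℝ 2 u x) : (hessMat u x).IsSymm := by
  ext i j
  exact partialDeriv_comm hu j i

theorem partialDeriv_of_eq_neg_log_add (hρ : ContDiffAt ℝ 2 ρ x) (hw : ContDiffAt ℝ 2 w x)
    (hpos : 0 < ρ x) (hu : u =ᶠ[𝓝 x] fun z => -Real.log (ρ z) + w z) (i : Fin n) :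
    partialDeriv i u x = -(partialDeriv i ρ x / ρ x) + partialDeriv i w x := by
  set f : ℝ → ℝ := fun t => -Real.log t with hf
  have h1 : u =ᶠ[𝓝 x] fun z => (fun z => (1 : ℝ) * f (ρ z)) z + w z := by
    simpa [hf] using hu
  have hl : HasDerivAt f ((fun t : ℝ => -t⁻¹) (ρ x)) (ρ x) :=
    (Real.hasDerivAt_log hpos.ne').neg
  have hd : DifferentiableAt ℝ (fun z => (1 : ℝ) * f (ρ z)) x :=
    (differentiableAt_const 1).fun_mul
      (hl.differentiableAt.comp x (hρ.differentiableAt (by simp)))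
  rw [(partialDeriv_congr h1 i).self_of_nhds, partialDeriv_add hd (hw.differentiableAt (by simp)),
    partialDeriv_mul_comp (f' := fun t => -t⁻¹) (differentiableAt_const 1)
      (hρ.differentiableAt (by simp)) hl,
    partialDeriv_const]
  field_simp
  ring

theorem partialDeriv₂_of_eq_neg_log_add (hρ : ContDiffAt ℝ 2 ρ x) (hw : ContDiffAt ℝ 2 w x)
    (hpos : 0 < ρ x) (hu : u =ᶠ[𝓝 x] fun z => -Real.log (ρ z) + w z) (i j : Fin n) :
    partialDeriv i (partialDeriv j u) x
      = partialDeriv i ρ x * partialDeriv j ρ x / ρ x ^ 2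
        - partialDeriv i (partialDeriv j ρ) x / ρ x + partialDeriv i (partialDeriv j w) x := by
  set f : ℝ → ℝ := fun t => -Real.log t with hf
  have hl : ∀ᶠ t in 𝓝 (ρ x), HasDerivAt f ((fun t : ℝ => -t⁻¹) t) t := by
    filter_upwards [lt_mem_nhds hpos] with t ht
    exact (Real.hasDerivAt_log ht.ne').neg
  have hl' : HasDerivAt (fun t : ℝ => -t⁻¹) (ρ x ^ 2)⁻¹ (ρ x) := by
    simpa using (hasDerivAt_inv hpos.ne').fun_neg
  have hcd : ContDiffAt ℝ 2 (fun z => (1 : ℝ) * f (ρ z)) x :=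
    contDiffAt_const.mul (((Real.contDiffAt_log.mpr hpos.ne').neg).comp x hρ)
  have h2 : partialDeriv j u =ᶠ[𝓝 x]
      fun z => partialDeriv j (fun z => (1 : ℝ) * f (ρ z)) z + partialDeriv j w z := by
    have h1 : u =ᶠ[𝓝 x] fun z => (fun z => (1 : ℝ) * f (ρ z)) z + w z := by
      simpa [hf] using hu
    filter_upwards [partialDeriv_congr h1 j, hcd.eventually (by simp), hw.eventually (by simp)]
      with z h3 h4 h5
    rw [h3]
    exact partialDeriv_add (h4.differentiableAt (by simp)) (h5.differentiableAt (by simp)) j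
  rw [(partialDeriv_congr h2 i).self_of_nhds, partialDeriv_add
    ((contDiffAt_partialDeriv (m' := 1) hcd le_rfl j).differentiableAt (by simp))
    ((contDiffAt_partialDeriv (m' := 1) hw le_rfl j).differentiableAt (by simp)),
    partialDeriv₂_mul_comp contDiffAt_const hρ hl hl']
  simp only [partialDeriv_const]
  field_simp
  ring

/-- The singular terms of `A(-log ρ + w)` are `ρ⁻² ((n-2) ∇ρ ⊗ ∇ρ + I + (n-2) (I - ∇ρ ⊗ ∇ρ))`, since
`|∇ρ| = 1`, and this is `(n-1) ρ⁻² I`. -/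
theorem sq_smul_matrixA (hρ : ContDiffAt ℝ 2 ρ x) (hw : ContDiffAt ℝ 2 w x) (hpos : 0 < ρ x)
    (hnorm : ∑ i, partialDeriv i ρ x ^ 2 = 1)
    (hu : u =ᶠ[𝓝 x] fun z => -Real.log (ρ z) + w z) :
    ρ x ^ 2 • matrixA u x = ((n : ℝ) - 1) • (1 : Matrix (Fin n) (Fin n) ℝ)
      + ρ x • rescaledMatrix (ρ x) (gradVec ρ x) (gradVec w x) (hessMat ρ x) (hessMat w x) := by
  have hg := partialDeriv_of_eq_neg_log_add hρ hw hpos hu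
  have hh := partialDeriv₂_of_eq_neg_log_add hρ hw hpos hu
  have h0 := hpos.ne'
  have e1 : ∑ l, partialDeriv l (partialDeriv l u) x
      = 1 / ρ x ^ 2 - (hessMat ρ x).trace / ρ x + (hessMat w x).trace := by
    simp only [hh, Finset.sum_add_distrib, Finset.sum_sub_distrib, ← Finset.sum_div, ← pow_two,
      hnorm]
    rfl
  have e2 : ∑ l, partialDeriv l u x ^ 2
      = 1 / ρ x ^ 2 - 2 * (gradVec ρ x ⬝ᵥ gradVec w x) / ρ x + gradVec w x ⬝ᵥ gradVec w x := by
    have : ∀ l, partialDeriv l u x ^ 2 = partialDeriv l ρ x ^ 2 / ρ x ^ 2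
        - 2 / ρ x * (partialDeriv l ρ x * partialDeriv l w x)
        + partialDeriv l w x * partialDeriv l w x := by
      intro l
      rw [hg]
      field_simp
      ring
    simp only [this, Finset.sum_add_distrib, Finset.sum_sub_distrib, ← Finset.sum_div, hnorm,
      ← Finset.mul_sum]
    simp only [dotProduct, gradVec]
    ring
  ext i j
  have e3 : ∀ v z, gradVec v z i = partialDeriv i v z := fun v z => rfl
  have e4 : ∀ v z, gradVec v z j = partialDeriv j v z := fun v z => rfl
  have e5 : ∀ v z, hessMat v z i j = partialDeriv i (partialDeriv j v) z := fun v z => rfl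
  rw [matrixA, e1, e2]
  simp only [Matrix.smul_apply, Matrix.add_apply, Matrix.sub_apply,
    Matrix.of_apply, hg, hh, rescaledMatrix, Matrix.vecMulVec_apply, smul_eq_mul, e3, e4, e5]
  field_simp
  ring

/-- The factor `d^{2k}` makes the singular terms of `F(u)` disappear: `σ_k` is homogeneous of degree
`k`, and `e^{-2k log d} d^{2k} = 1`. -/
theorem opFtilde_eq {k : ℕ} (hk : k ≤ n) (hρ : ContDiffAt ℝ 2 ρ x) (hw : ContDiffAt ℝ 2 w x)
    (hpos : 0 < ρ x) (hnorm : ∑ i, partialDeriv i ρ x ^ 2 = 1)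
    (hu : u =ᶠ[𝓝 x] fun z => -Real.log (ρ z) + w z) (hb : bdist Ω x = ρ x) :
    opFtilde Ω k u x = sigma k (((n : ℝ) - 1) • (1 : Matrix (Fin n) (Fin n) ℝ)
      + ρ x • rescaledMatrix (ρ x) (gradVec ρ x) (gradVec w x) (hessMat ρ x) (hessMat w x))
      - (n.choose k : ℝ) * ((n : ℝ) - 1) ^ k * Real.exp (2 * (k : ℝ) * w x) := by
  have hsR := isSymm_rescaledMatrix (ρ x) (gradVec ρ x) (gradVec w x) (isSymm_hessMat hρ)
    (isSymm_hessMat hw)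
  have hs : (ρ x ^ 2 • matrixA u x).IsSymm := by
    rw [sq_smul_matrixA hρ hw hpos hnorm hu]
    exact (Matrix.isSymm_one.smul _).add (hsR.smul _)
  have h2 : (ρ x ^ 2) ≠ 0 := pow_ne_zero 2 hpos.ne'
  have hA : (matrixA u x).IsSymm := by
    have := hs.smul (ρ x ^ 2)⁻¹
    rwa [smul_smul, inv_mul_cancel₀ h2, one_smul] at this
  rw [← sq_smul_matrixA hρ hw hpos hnorm hu, sigma_eq_sumMinors hk hs, sumMinors_smul,
    ← sigma_eq_sumMinors hk hA, opFtilde, opF, hb, hu.self_of_nhds]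
  have e : Real.exp (2 * (k : ℝ) * (-Real.log (ρ x) + w x)) * ρ x ^ (2 * k)
      = Real.exp (2 * (k : ℝ) * w x) := by
    have h3 : ρ x ^ (2 * k) = Real.exp (2 * (k : ℝ) * Real.log (ρ x)) := by
      have : (2 * (k : ℝ)) = ((2 * k : ℕ) : ℝ) := by push_cast; ring
      rw [this, Real.exp_nat_mul, Real.exp_log hpos]
    rw [h3, ← Real.exp_add]
    congr 1
    ring
  rw [sub_mul, mul_assoc _ (Real.exp _), e, ← pow_mul]
  ring

end Rescaled

/-! ### Limits of the rescaled operator -/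

section Limits

variable {α : Type*} {l : Filter α}

theorem tendsto_exp_sub_one_sub_id_div_sq {s d : α → ℝ} {a : ℝ} (hd : Tendsto d l (𝓝 0))
    (hd0 : ∀ᶠ x in l, d x ≠ 0) (h : Tendsto (fun x => s x / d x) l (𝓝 a)) :
    Tendsto (fun x => (Real.exp (s x) - 1 - s x) / d x ^ 2) l (𝓝 (a ^ 2 / 2)) := by
  have hs : Tendsto s l (𝓝 0) := by
    have := h.mul hd
    rw [mul_zero] at this
    refine this.congr' ?_
    filter_upwards [hd0] with x hx
    field_simp
  have h1 : Tendsto (fun x => (Real.exp (s x) - 1 - s x - s x ^ 2 / 2) / d x ^ 2) l (𝓝 0) := by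
    -- `4 / 18` is the constant in the cubic Taylor estimate `Real.exp_bound`
    have h2 : Tendsto (fun x => |s x / d x| ^ 2 * |s x| * (4 / 18)) l
        (𝓝 (|a| ^ 2 * |0| * (4 / 18))) :=
      ((h.abs.pow 2).mul hs.abs).mul_const _
    rw [abs_zero, mul_zero, zero_mul] at h2
    refine squeeze_zero_norm' ?_ h2
    have hs1 : ∀ᶠ x in l, |s x| < 1 := by
      have := hs.abs
      rw [abs_zero] at this
      exact this.eventually_lt_const one_pos
    filter_upwards [hd0, hs1] with x hx hx1
    have h3 := Real.exp_bound hx1.le (n := 3) (by norm_num)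
    have h4 : Real.exp (s x) - ∑ m ∈ Finset.range 3, s x ^ m / (m.factorial : ℝ)
        = Real.exp (s x) - 1 - s x - s x ^ 2 / 2 := by
      simp [Finset.sum_range_succ, Nat.factorial]
      ring
    rw [h4] at h3
    rw [Real.norm_eq_abs, abs_div, abs_div, abs_of_nonneg (sq_nonneg (d x)), div_pow, sq_abs (d x),
      div_le_iff₀ (by positivity)]
    refine h3.trans (le_of_eq ?_)
    have : d x ^ 2 ≠ 0 := pow_ne_zero 2 hx
    norm_num [Nat.factorial]
    field_simp
    rw [← sq_abs (s x)]
    ring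
  have h5 := h1.add ((h.pow 2).div_const 2)
  rw [zero_add] at h5
  refine h5.congr' ?_
  filter_upwards [hd0] with x hx
  field_simp
  ring

variable {n k : ℕ} {m : ℝ} {d w : α → ℝ} {Y : α → Matrix (Fin n) (Fin n) ℝ}
  {Y₀ : Matrix (Fin n) (Fin n) ℝ}

theorem tendsto_sigma_sub_exp (hn : 2 ≤ n) (hk : k ≤ n)
    (hd : Tendsto d l (𝓝 0)) (hd0 : ∀ᶠ x in l, d x ≠ 0) (hY : Tendsto Y l (𝓝 Y₀))
    (hs : ∀ᶠ x in l, (Y x).IsSymm) (hs₀ : Y₀.IsSymm) {c₀ : ℝ} (hw : Tendsto w l (𝓝 c₀)) :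
    Tendsto (fun x => sigma k (m • (1 : Matrix (Fin n) (Fin n) ℝ) + d x • Y x)
      - (n.choose k : ℝ) * m ^ k * Real.exp (2 * (k : ℝ) * w x)) l
      (𝓝 ((n.choose k : ℝ) * m ^ k * (1 - Real.exp (2 * (k : ℝ) * c₀)))) := by
  have h := tendsto_sigma_smul_one_add hn hk m hd hd0 hY hs hs₀
  have htr : Tendsto (fun x => (Y x).trace) l (𝓝 Y₀.trace) :=
    ((continuous_id.matrix_trace).tendsto Y₀).comp hY
  have h1 := ((h.mul (hd.pow 2)).add
    ((hd.const_mul (((n - 1).choose (n - k) : ℝ) * m ^ (k - 1))).mul htr)).add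
    (((Real.continuous_exp.tendsto _).comp (hw.const_mul (2 * (k : ℝ)))).const_sub 1
      |>.const_mul ((n.choose k : ℝ) * m ^ k))
  have e : ∀ q z : ℝ, q * 0 ^ 2 + ((n - 1).choose (n - k) : ℝ) * m ^ (k - 1) * 0 * Y₀.trace + z
      = z := fun q z => by ring
  rw [e] at h1
  refine h1.congr' ?_
  filter_upwards [hd0] with x hx
  simp only [Function.comp_apply]
  field_simp
  ring

theorem tendsto_sigma_sub_exp_div (hn : 2 ≤ n) (hk : k ≤ n)
    (hd : Tendsto d l (𝓝 0)) (hd0 : ∀ᶠ x in l, d x ≠ 0) (hY : Tendsto Y l (𝓝 Y₀))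
    (hs : ∀ᶠ x in l, (Y x).IsSymm) (hs₀ : Y₀.IsSymm) {c₁ : ℝ}
    (hw : Tendsto (fun x => w x / d x) l (𝓝 c₁)) :
    Tendsto (fun x => (sigma k (m • (1 : Matrix (Fin n) (Fin n) ℝ) + d x • Y x)
      - (n.choose k : ℝ) * m ^ k * Real.exp (2 * (k : ℝ) * w x)) / d x) l
      (𝓝 (((n - 1).choose (n - k) : ℝ) * m ^ (k - 1) * Y₀.trace
        - (n.choose k : ℝ) * m ^ k * (2 * k * c₁))) := by
  have h := tendsto_sigma_smul_one_add hn hk m hd hd0 hY hs hs₀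
  have htr : Tendsto (fun x => (Y x).trace) l (𝓝 Y₀.trace) :=
    ((continuous_id.matrix_trace).tendsto Y₀).comp hY
  have hsd : Tendsto (fun x => 2 * (k : ℝ) * w x / d x) l (𝓝 (2 * k * c₁)) := by
    simpa [mul_div_assoc] using hw.const_mul (2 * (k : ℝ))
  have hexp := tendsto_exp_sub_one_sub_id_div_sq hd hd0 hsd
  have h1 := ((h.mul hd).add (htr.const_mul (((n - 1).choose (n - k) : ℝ) * m ^ (k - 1)))).sub
    (((hexp.mul hd).add hsd).const_mul ((n.choose k : ℝ) * m ^ k))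
  rw [mul_zero, mul_zero, zero_add, zero_add] at h1
  refine h1.congr' ?_
  filter_upwards [hd0] with x hx
  field_simp
  ring

/-- The second-order limit. The linear part `γ` of `w` varies along the filter, and only its
combination with `tr Y` has to be known to first order. -/
theorem tendsto_sigma_sub_exp_div_sq (hn : 2 ≤ n) (hk : k ≤ n)
    (hd : Tendsto d l (𝓝 0)) (hd0 : ∀ᶠ x in l, d x ≠ 0) (hY : Tendsto Y l (𝓝 Y₀))
    (hs : ∀ᶠ x in l, (Y x).IsSymm) (hs₀ : Y₀.IsSymm) {γ : α → ℝ} {c₁ c₂ τ : ℝ}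
    (hγ : Tendsto γ l (𝓝 c₁)) (hw : Tendsto (fun x => (w x - γ x * d x) / d x ^ 2) l (𝓝 c₂))
    (htr : Tendsto (fun x => (((n - 1).choose (n - k) : ℝ) * m ^ (k - 1) * (Y x).trace
      - (n.choose k : ℝ) * m ^ k * (2 * k * γ x)) / d x) l (𝓝 τ)) :
    Tendsto (fun x => (sigma k (m • (1 : Matrix (Fin n) (Fin n) ℝ) + d x • Y x)
      - (n.choose k : ℝ) * m ^ k * Real.exp (2 * (k : ℝ) * w x)) / d x ^ 2) l
      (𝓝 (((n - 2).choose (n - k) : ℝ) * m ^ (k - 2) * ((Y₀.trace ^ 2 - (Y₀ * Y₀).trace) / 2) + τ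
        - (n.choose k : ℝ) * m ^ k * (2 * k * c₂ + 2 * k ^ 2 * c₁ ^ 2))) := by
  have h := tendsto_sigma_smul_one_add hn hk m hd hd0 hY hs hs₀
  have hsd : Tendsto (fun x => 2 * (k : ℝ) * w x / d x) l (𝓝 (2 * k * c₁)) := by
    have h2 := ((hw.mul hd).add hγ).const_mul (2 * (k : ℝ))
    rw [mul_zero, zero_add] at h2
    refine h2.congr' ?_
    filter_upwards [hd0] with x hx
    field_simp
    ring
  have hexp := tendsto_exp_sub_one_sub_id_div_sq hd hd0 hsd
  have h1 := (h.add htr).sub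
    ((((hw.const_mul (2 * (k : ℝ))).add hexp)).const_mul ((n.choose k : ℝ) * m ^ k))
  have e : (2 * (k : ℝ) * c₁) ^ 2 / 2 = 2 * k ^ 2 * c₁ ^ 2 := by ring
  rw [e] at h1
  refine h1.congr' ?_
  filter_upwards [hd0] with x hx
  field_simp
  ring

end Limits

/-! ### The expansion at a boundary point -/

section Constants

theorem choose_mul_eq {n k : ℕ} (hk : 1 ≤ k) (hkn : k ≤ n) :
    (n.choose k : ℝ) * k = n * ((n - 1).choose (n - k) : ℝ) := by
  obtain ⟨j, rfl⟩ := Nat.exists_eq_add_of_le hk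
  obtain ⟨i, rfl⟩ := Nat.exists_eq_add_of_le hkn
  have e1 : 1 + j + i - 1 = j + i := by omega
  have e2 : 1 + j + i - (1 + j) = i := by omega
  rw [e1, e2, Nat.choose_symm_add.symm]
  have h := Nat.add_one_mul_choose_eq (j + i) j
  have e3 : 1 + j + i = j + i + 1 := by omega
  rw [e3, add_comm 1 j]
  exact_mod_cast h.symm

/-- `C(n-2, k-2) m^{k-2}` in terms of `C(n-1, k-1) m^{k-1}` for `m = n - 1`. Both sides vanish if
`k = 1`, although `k - 2` is then truncated. -/
theorem choose_mul_pow_eq {n k : ℕ} (hn : 2 ≤ n) (hk : 1 ≤ k) (hkn : k ≤ n) :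
    ((n - 2).choose (n - k) : ℝ) * ((n : ℝ) - 1) ^ (k - 2) * ((n : ℝ) - 1) ^ 2
      = ((k : ℝ) - 1) * (((n - 1).choose (n - k) : ℝ) * ((n : ℝ) - 1) ^ (k - 1)) := by
  rcases Nat.lt_or_ge k 2 with h | h
  · have : k = 1 := by omega
    subst this
    rw [Nat.choose_eq_zero_of_lt (by omega)]
    simp
  · have h1 := choose_mul_eq (n := n - 1) (k := k - 1) (by omega) (by omega)
    have e1 : n - 1 - 1 = n - 2 := by omega
    have e2 : n - 1 - (k - 1) = n - k := by omega
    have e3 : (n - 1).choose (k - 1) = (n - 1).choose (n - k) := by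
      rw [← Nat.choose_symm (by omega : k - 1 ≤ n - 1), e2]
    rw [e1, e2, e3, Nat.cast_sub hk, Nat.cast_sub (by omega : 1 ≤ n)] at h1
    have e4 : ((n : ℝ) - 1) ^ (k - 1) = ((n : ℝ) - 1) ^ (k - 2) * ((n : ℝ) - 1) := by
      rw [← pow_succ]
      congr 1
      omega
    rw [e4]
    push_cast at h1
    linear_combination -((n : ℝ) - 1) ^ (k - 2) * ((n : ℝ) - 1) * h1

end Constants

section Expansion

variable {n k : ℕ} {Ω : Set (E n)} {p : E n} {y : E n → E n} {ρ : E n → ℝ}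

theorem tendsto_gradVec {u : E n → ℝ} (hu : ContDiffAt ℝ ∞ u p) :
    Tendsto (gradVec u) (𝓝[Ω] p) (𝓝 (gradVec u p)) :=
  tendsto_pi_nhds.mpr fun i =>
    (contDiffAt_partialDeriv (m' := ∞) hu (by simp) i).continuousAt.tendsto.mono_left
      nhdsWithin_le_nhds

theorem tendsto_hessMat {u : E n → ℝ} (hu : ContDiffAt ℝ ∞ u p) :
    Tendsto (hessMat u) (𝓝[Ω] p) (𝓝 (hessMat u p)) :=
  tendsto_pi_nhds.mpr fun i => tendsto_pi_nhds.mpr fun j =>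
    (contDiffAt_partialDeriv (m' := ∞) (contDiffAt_partialDeriv (m' := ∞) hu (by simp) j)
      (by simp) i).continuousAt.tendsto.mono_left nhdsWithin_le_nhds

theorem IsRemainder.tendsto_zero {r : E n → ℝ} (h : IsNormalCoordinates Ω p y ρ)
    (hr : IsRemainder (𝓝[Ω] p) ρ r) : Tendsto r (𝓝[Ω] p) (𝓝 0) := by
  have h1 := hr.tendsto_div_sq.mul ((h.tendsto_dist.mono_right nhdsWithin_le_nhds).pow 2)
  rw [zero_mul] at h1
  refine h1.congr' ?_
  filter_upwards [h.eventually_eq] with x hx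
  have := hx.1.ne'
  field_simp

theorem IsRemainder.tendsto_partialDeriv {r : E n → ℝ} (h : IsNormalCoordinates Ω p y ρ)
    (hr : IsRemainder (𝓝[Ω] p) ρ r) (i : Fin n) :
    Tendsto (partialDeriv i r) (𝓝[Ω] p) (𝓝 0) := by
  have h1 := (hr.tendsto_partialDeriv_div i).mul (h.tendsto_dist.mono_right nhdsWithin_le_nhds)
  rw [zero_mul] at h1
  refine h1.congr' ?_
  filter_upwards [h.eventually_eq] with x hx
  have := hx.1.ne'
  field_simp

theorem eventually_smooth_within {u : E n → ℝ} (hu : ContDiffAt ℝ ∞ u p) :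
    ∀ᶠ x in 𝓝[Ω] p, ContDiffAt ℝ 2 u x :=
  mem_nhdsWithin_of_mem_nhds ((hu.of_le (natCast_le_infty 2)).eventually (by simp))

theorem eventually_gradVec_add {w r : E n → ℝ} (hw : ContDiffAt ℝ ∞ w p)
    (hr : IsRemainder (𝓝[Ω] p) ρ r) :
    ∀ᶠ x in 𝓝[Ω] p, gradVec (fun z => w z + r z) x = gradVec w x + gradVec r x := by
  filter_upwards [eventually_smooth_within hw, hr.smooth] with x h1 h2
  funext i
  exact partialDeriv_add (h1.differentiableAt (by simp)) (h2.differentiableAt (by simp)) i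

theorem eventually_hessMat_add {w r : E n → ℝ} (hw : ContDiffAt ℝ ∞ w p)
    (hr : IsRemainder (𝓝[Ω] p) ρ r) :
    ∀ᶠ x in 𝓝[Ω] p, hessMat (fun z => w z + r z) x = hessMat w x + hessMat r x := by
  filter_upwards [eventually_smooth_within hw, hr.smooth] with x h1 h2
  ext i j
  have h3 : partialDeriv j (fun z => w z + r z) =ᶠ[𝓝 x]
      fun z => partialDeriv j w z + partialDeriv j r z := by
    filter_upwards [h1.eventually (by simp), h2.eventually (by simp)] with z h4 h5
    exact partialDeriv_add (h4.differentiableAt (by simp)) (h5.differentiableAt (by simp)) j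
  simp only [hessMat, Matrix.of_apply, Matrix.add_apply]
  rw [(partialDeriv_congr h3 i).self_of_nhds, partialDeriv_add
    ((contDiffAt_partialDeriv (m' := 1) h1 le_rfl j).differentiableAt (by simp))
    ((contDiffAt_partialDeriv (m' := 1) h2 le_rfl j).differentiableAt (by simp))]

theorem tendsto_gradVec_add {w r : E n → ℝ} (h : IsNormalCoordinates Ω p y ρ)
    (hw : ContDiffAt ℝ ∞ w p) (hr : IsRemainder (𝓝[Ω] p) ρ r) :
    Tendsto (gradVec fun z => w z + r z) (𝓝[Ω] p) (𝓝 (gradVec w p)) := by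
  have h1 : Tendsto (gradVec r) (𝓝[Ω] p) (𝓝 0) :=
    tendsto_pi_nhds.mpr fun i => hr.tendsto_partialDeriv h i
  have h2 := (tendsto_gradVec (Ω := Ω) hw).add h1
  rw [add_zero] at h2
  exact h2.congr' ((eventually_gradVec_add hw hr).mono fun x hx => hx.symm)

theorem tendsto_hessMat_add {w r : E n → ℝ}
    (hw : ContDiffAt ℝ ∞ w p) (hr : IsRemainder (𝓝[Ω] p) ρ r) :
    Tendsto (hessMat fun z => w z + r z) (𝓝[Ω] p) (𝓝 (hessMat w p)) := by
  have h1 : Tendsto (hessMat r) (𝓝[Ω] p) (𝓝 0) :=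
    tendsto_pi_nhds.mpr fun i => tendsto_pi_nhds.mpr fun j => hr.tendsto_partialDeriv₂ i j
  have h2 := (tendsto_hessMat (Ω := Ω) hw).add h1
  rw [add_zero] at h2
  exact h2.congr' ((eventually_hessMat_add hw hr).mono fun x hx => hx.symm)

/-- The matrix `Y` of `rescaledMatrix`, for functions `ρ` and `w`, at the point `x`. -/
noncomputable def rescaledMatrixAt (ρ w : E n → ℝ) (x : E n) : Matrix (Fin n) (Fin n) ℝ :=
  rescaledMatrix (ρ x) (gradVec ρ x) (gradVec w x) (hessMat ρ x) (hessMat w x)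

theorem tendsto_rescaledMatrixAt {w r : E n → ℝ} (h : IsNormalCoordinates Ω p y ρ)
    (hw : ContDiffAt ℝ ∞ w p) (hr : IsRemainder (𝓝[Ω] p) ρ r) :
    Tendsto (rescaledMatrixAt ρ fun z => w z + r z) (𝓝[Ω] p)
      (𝓝 (rescaledMatrix 0 (gradVec ρ p) (gradVec w p) (hessMat ρ p) (hessMat w p))) :=
  tendsto_rescaledMatrix (h.tendsto_dist.mono_right nhdsWithin_le_nhds)
    (tendsto_gradVec h.smooth_dist) (tendsto_gradVec_add h hw hr) (tendsto_hessMat h.smooth_dist)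
    (tendsto_hessMat_add hw hr)

theorem eventually_isSymm_rescaledMatrixAt {w r : E n → ℝ} (h : IsNormalCoordinates Ω p y ρ)
    (hw : ContDiffAt ℝ ∞ w p) (hr : IsRemainder (𝓝[Ω] p) ρ r) :
    ∀ᶠ x in 𝓝[Ω] p, (rescaledMatrixAt ρ (fun z => w z + r z) x).IsSymm := by
  filter_upwards [eventually_smooth_within h.smooth_dist, eventually_smooth_within hw, hr.smooth]
    with x h1 h2 h3
  exact isSymm_rescaledMatrix _ _ _ (isSymm_hessMat h1) (isSymm_hessMat (h2.add h3))

theorem isSymm_hessMat_of_smooth {u : E n → ℝ} (hu : ContDiffAt ℝ ∞ u p) : (hessMat u p).IsSymm :=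
  isSymm_hessMat (hu.of_le (natCast_le_infty 2))

theorem eventually_opFtilde_eq {u w r : E n → ℝ} (hk : k ≤ n) (hΩ : IsOpen Ω)
    (h : IsNormalCoordinates Ω p y ρ) (hw : ContDiffAt ℝ ∞ w p) (hr : IsRemainder (𝓝[Ω] p) ρ r)
    (hu : ∀ᶠ x in 𝓝[Ω] p, u x = -Real.log (ρ x) + (w x + r x)) :
    ∀ᶠ x in 𝓝[Ω] p, opFtilde Ω k u x
      = sigma k (((n : ℝ) - 1) • (1 : Matrix (Fin n) (Fin n) ℝ)
        + ρ x • rescaledMatrixAt ρ (fun z => w z + r z) x)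
      - (n.choose k : ℝ) * ((n : ℝ) - 1) ^ k * Real.exp (2 * (k : ℝ) * (w x + r x)) := by
  filter_upwards [eventually_smooth_within h.smooth_dist, eventually_smooth_within hw, hr.smooth,
    h.eventually_eq, mem_nhdsWithin_of_mem_nhds h.sum_partialDeriv_sq,
    eventually_eventually_nhdsWithin.mpr hu, self_mem_nhdsWithin] with x h1 h2 h3 h4 h5 h6 h7
  rw [hΩ.nhdsWithin_eq h7] at h6
  exact opFtilde_eq hk h1 (h2.add h3) h4.1 h5 h6 h4.2.1

variable {c : ℕ → E n → ℝ} {cn1 : E n → ℝ}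

/-- Near a boundary point the ansatz is `-log ρ + C₀ + C₁ ρ + C₂ ρ²` up to a remainder. -/
theorem exists_ansatz_eq (hn : 3 ≤ n) (h : IsNormalCoordinates Ω p y ρ) (hp : p ∈ frontier Ω)
    (hc : SmoothCoefficients Ω c cn1) :
    ∃ r, IsRemainder (𝓝[Ω] p) ρ r ∧ ∀ᶠ x in 𝓝[Ω] p, ansatz Ω c cn1 x
      = -Real.log (ρ x) + ((c 0 (y x) + (c 1 (y x) * ρ x + c 2 (y x) * ρ x ^ 2)) + r x) := by
  obtain ⟨m, rfl⟩ := Nat.exists_eq_add_of_le' hn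
  refine ⟨fun x => ∑ i ∈ Finset.range m, (c (i + 3) ∘ y) x * ρ x ^ (i + 3)
    + (cn1 ∘ y) x * (ρ x ^ (m + 3) * Real.log (ρ x)), ?_, ?_⟩
  · refine IsRemainder.add (IsRemainder.sum _ fun i hi => ?_) ?_
    · have hi' := Finset.mem_range.mp hi
      exact h.isRemainder_mul_pow (h.contDiffAt_comp_foot hp (hc.1 (i + 3) (by omega))) i
    · exact h.isRemainder_mul_pow_mul_log (h.contDiffAt_comp_foot hp hc.2) m
  · filter_upwards [h.eventually_eq] with x hx
    rw [ansatz, hx.2.1, hx.2.2, Finset.sum_range_succ', Finset.sum_range_succ',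
      Finset.sum_range_succ']
    simp only [Function.comp_apply]
    ring

theorem contDiffAt_coefficient_terms (hn : 3 ≤ n) (h : IsNormalCoordinates Ω p y ρ)
    (hp : p ∈ frontier Ω) (hc : SmoothCoefficients Ω c cn1) :
    ContDiffAt ℝ ∞ (fun x => (c 1 ∘ y) x * ρ x + (c 2 ∘ y) x * ρ x ^ 2) p :=
  ((h.contDiffAt_comp_foot hp (hc.1 1 (by omega))).mul h.smooth_dist).add
    ((h.contDiffAt_comp_foot hp (hc.1 2 (by omega))).mul (h.smooth_dist.pow 2))

/-- The zeroth coefficient of `F̃(v)`. -/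
theorem tendsto_opFtilde (hn : 3 ≤ n) (hk : k ≤ n) (hΩ : IsOpen Ω)
    (h : IsNormalCoordinates Ω p y ρ) (hp : p ∈ frontier Ω) (hc : SmoothCoefficients Ω c cn1) :
    Tendsto (opFtilde Ω k (ansatz Ω c cn1)) (𝓝[Ω] p)
      (𝓝 ((n.choose k : ℝ) * ((n : ℝ) - 1) ^ k * (1 - Real.exp (2 * (k : ℝ) * c 0 p)))) := by
  obtain ⟨r, hr, hu⟩ := exists_ansatz_eq hn h hp hc
  have hw : ContDiffAt ℝ ∞
      (fun x => c 0 (y x) + (c 1 (y x) * ρ x + c 2 (y x) * ρ x ^ 2)) p :=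
    (h.contDiffAt_comp_foot hp (hc.1 0 (by omega))).add (contDiffAt_coefficient_terms hn h hp hc)
  have hd0 : ∀ᶠ x in 𝓝[Ω] p, ρ x ≠ 0 := h.eventually_eq.mono fun x hx => hx.1.ne'
  have hlim := (hw.continuousAt.tendsto.mono_left nhdsWithin_le_nhds).add (hr.tendsto_zero h)
  simp only [h.foot_self, h.dist_self, mul_zero, add_zero, ne_eq, OfNat.ofNat_ne_zero,
    not_false_eq_true, zero_pow] at hlim
  refine (tendsto_sigma_sub_exp (m := (n : ℝ) - 1) (by omega) hk
    (h.tendsto_dist.mono_right nhdsWithin_le_nhds) hd0 (tendsto_rescaledMatrixAt h hw hr)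
    (eventually_isSymm_rescaledMatrixAt h hw hr)
    (isSymm_rescaledMatrix _ _ _ (isSymm_hessMat_of_smooth h.smooth_dist)
      (isSymm_hessMat_of_smooth hw)) hlim).congr' ?_
  exact (eventually_opFtilde_eq hk hΩ h hw hr hu).mono fun x hx => hx.symm

theorem exists_ansatz_eq_of_zero (hn : 3 ≤ n) (h : IsNormalCoordinates Ω p y ρ)
    (hp : p ∈ frontier Ω) (hc : SmoothCoefficients Ω c cn1) (h0 : ∀ q ∈ frontier Ω, c 0 q = 0) :
    ∃ r, IsRemainder (𝓝[Ω] p) ρ r ∧ ∀ᶠ x in 𝓝[Ω] p, ansatz Ω c cn1 x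
      = -Real.log (ρ x) + (((c 1 ∘ y) x * ρ x + (c 2 ∘ y) x * ρ x ^ 2) + r x) := by
  obtain ⟨r, hr, hu⟩ := exists_ansatz_eq hn h hp hc
  refine ⟨r, hr, ?_⟩
  filter_upwards [hu, mem_nhdsWithin_of_mem_nhds h.foot_mem] with x h1 h2
  rw [h1, h0 _ h2, zero_add]
  rfl

theorem partialDeriv_coefficient_terms {C₁ C₂ : E n → ℝ} {x : E n} (h1 : DifferentiableAt ℝ C₁ x)
    (h2 : DifferentiableAt ℝ C₂ x) (hρ : DifferentiableAt ℝ ρ x) (i : Fin n) :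
    partialDeriv i (fun z => C₁ z * ρ z + C₂ z * ρ z ^ 2) x
      = partialDeriv i C₁ x * ρ x + C₁ x * partialDeriv i ρ x
        + (partialDeriv i C₂ x * ρ x ^ 2 + C₂ x * (2 * ρ x * partialDeriv i ρ x)) := by
  have hq : HasDerivAt (fun t : ℝ => t ^ 2) ((fun t : ℝ => 2 * t) (ρ x)) (ρ x) := by
    simpa using hasDerivAt_pow 2 (ρ x)
  rw [partialDeriv_add (h1.fun_mul hρ) (h2.fun_mul (hρ.fun_pow 2)), partialDeriv_mul h1 hρ,
    partialDeriv_mul_comp (f := fun t => t ^ 2) (f' := fun t => 2 * t) h2 hρ hq]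

/-- On `{ρ = 0}` the Laplacian of `C₁ ρ + C₂ ρ²` is `C₁ Δρ + 2 C₂`, if the derivative of `C₁` along
`∇ρ` vanishes. -/
theorem trace_hessMat_coefficient_terms {C₁ C₂ : E n → ℝ} {x : E n} (h1 : ContDiffAt ℝ 2 C₁ x)
    (h2 : ContDiffAt ℝ 2 C₂ x) (hρ : ContDiffAt ℝ 2 ρ x) (h0 : ρ x = 0)
    (hnorm : ∑ i, partialDeriv i ρ x ^ 2 = 1)
    (hC : ∑ i, partialDeriv i C₁ x * partialDeriv i ρ x = 0) :
    (hessMat (fun z => C₁ z * ρ z + C₂ z * ρ z ^ 2) x).trace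
      = C₁ x * (hessMat ρ x).trace + 2 * C₂ x := by
  have hid : ∀ᶠ t in 𝓝 (ρ x), HasDerivAt (fun t : ℝ => t) ((fun _ : ℝ => 1) t) t :=
    Eventually.of_forall fun t => hasDerivAt_id t
  have hid' : HasDerivAt (fun _ : ℝ => (1 : ℝ)) 0 (ρ x) := hasDerivAt_const _ _
  have hq : ∀ᶠ t in 𝓝 (ρ x), HasDerivAt (fun t : ℝ => t ^ 2) ((fun t : ℝ => 2 * t) t) t :=
    Eventually.of_forall fun t => by simpa using hasDerivAt_pow 2 t
  have hq' : HasDerivAt (fun t : ℝ => 2 * t) 2 (ρ x) := by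
    simpa using (hasDerivAt_id (ρ x)).const_mul 2
  have hs1 : ContDiffAt ℝ 2 (fun z => C₁ z * ρ z) x := h1.mul hρ
  have hs2 : ContDiffAt ℝ 2 (fun z => C₂ z * ρ z ^ 2) x := h2.mul (hρ.pow 2)
  have key : ∀ i, partialDeriv i (partialDeriv i fun z => C₁ z * ρ z + C₂ z * ρ z ^ 2) x
      = 2 * (partialDeriv i C₁ x * partialDeriv i ρ x)
        + C₁ x * partialDeriv i (partialDeriv i ρ) x + 2 * C₂ x * partialDeriv i ρ x ^ 2 := by
    intro i
    have h3 : partialDeriv i (fun z => C₁ z * ρ z + C₂ z * ρ z ^ 2) =ᶠ[𝓝 x]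
        fun z => partialDeriv i (fun z => C₁ z * ρ z) z
          + partialDeriv i (fun z => C₂ z * ρ z ^ 2) z := by
      filter_upwards [hs1.eventually (by simp), hs2.eventually (by simp)] with z h4 h5
      exact partialDeriv_add (h4.differentiableAt (by simp)) (h5.differentiableAt (by simp)) i
    rw [(partialDeriv_congr h3 i).self_of_nhds, partialDeriv_add
      ((contDiffAt_partialDeriv (m' := 1) hs1 le_rfl i).differentiableAt (by simp))
      ((contDiffAt_partialDeriv (m' := 1) hs2 le_rfl i).differentiableAt (by simp)),
      partialDeriv₂_mul_comp (f := fun t => t) h1 hρ hid hid',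
      partialDeriv₂_mul_comp (f := fun t => t ^ 2) h2 hρ hq hq', h0]
    ring
  simp only [Matrix.trace, Matrix.diag_apply, hessMat, Matrix.of_apply, key,
    Finset.sum_add_distrib, ← Finset.mul_sum, hnorm, hC]
  ring

theorem gradVec_coefficient_terms (hn : 3 ≤ n) (h : IsNormalCoordinates Ω p y ρ)
    (hp : p ∈ frontier Ω) (hc : SmoothCoefficients Ω c cn1) :
    gradVec (fun x => (c 1 ∘ y) x * ρ x + (c 2 ∘ y) x * ρ x ^ 2) p = c 1 p • gradVec ρ p := by
  funext i
  rw [gradVec, partialDeriv_coefficient_terms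
    ((h.contDiffAt_comp_foot hp (hc.1 1 (by omega))).differentiableAt (by simp))
    ((h.contDiffAt_comp_foot hp (hc.1 2 (by omega))).differentiableAt (by simp))
    (h.smooth_dist.differentiableAt (by simp))]
  simp [h.dist_self, h.foot_self, gradVec]

theorem gradVec_dotProduct_self (h : IsNormalCoordinates Ω p y ρ) :
    gradVec ρ p ⬝ᵥ gradVec ρ p = 1 := by
  have := h.sum_partialDeriv_sq.self_of_nhds
  simpa [dotProduct, gradVec, pow_two] using this

theorem trace_hessMat (h : IsNormalCoordinates Ω p y ρ) :
    (hessMat ρ p).trace = -meanCurvature Ω p := by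
  rw [h.meanCurvature_eq, neg_neg]
  rfl

/-- The first coefficient of `F̃(v)` when `c₀ = 0`. -/
theorem tendsto_opFtilde_div (hn : 3 ≤ n) (hk1 : 1 ≤ k) (hk : k ≤ n) (hΩ : IsOpen Ω)
    (h : IsNormalCoordinates Ω p y ρ) (hp : p ∈ frontier Ω) (hc : SmoothCoefficients Ω c cn1)
    (h0 : ∀ q ∈ frontier Ω, c 0 q = 0) :
    Tendsto (fun x => opFtilde Ω k (ansatz Ω c cn1) x / bdist Ω x) (𝓝[Ω] p)
      (𝓝 (((n - 1).choose (n - k) : ℝ) * ((n : ℝ) - 1) ^ (k - 1) * (2 * ((n : ℝ) - 1))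
        * (meanCurvature Ω p - 2 * ((n : ℝ) - 1) * c 1 p))) := by
  obtain ⟨r, hr, hu⟩ := exists_ansatz_eq_of_zero hn h hp hc h0
  have hw := contDiffAt_coefficient_terms hn h hp hc
  have hd0 : ∀ᶠ x in 𝓝[Ω] p, ρ x ≠ 0 := h.eventually_eq.mono fun x hx => hx.1.ne'
  have hρ0 : Tendsto ρ (𝓝[Ω] p) (𝓝 0) := h.tendsto_dist.mono_right nhdsWithin_le_nhds
  have hC : ∀ i < n, Tendsto (c i ∘ y) (𝓝[Ω] p) (𝓝 (c i p)) := fun i hi => by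
    have := (h.contDiffAt_comp_foot hp (hc.1 i hi)).continuousAt.tendsto
    rw [Function.comp_apply, h.foot_self] at this
    exact this.mono_left nhdsWithin_le_nhds
  have hlim : Tendsto (fun x => ((c 1 ∘ y) x * ρ x + (c 2 ∘ y) x * ρ x ^ 2 + r x) / ρ x) (𝓝[Ω] p)
      (𝓝 (c 1 p)) := by
    have := ((hC 1 (by omega)).add ((hC 2 (by omega)).mul hρ0)).add (hr.tendsto_div_sq.mul hρ0)
    rw [mul_zero, mul_zero, add_zero, add_zero] at this
    refine this.congr' ?_
    filter_upwards [hd0] with x hx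
    field_simp
  have hfin := tendsto_sigma_sub_exp_div (m := (n : ℝ) - 1) (by omega) hk
    hρ0 hd0 (tendsto_rescaledMatrixAt h hw hr)
    (eventually_isSymm_rescaledMatrixAt h hw hr)
    (isSymm_rescaledMatrix _ _ _ (isSymm_hessMat_of_smooth h.smooth_dist)
      (isSymm_hessMat_of_smooth hw)) hlim
  have e : ((n - 1).choose (n - k) : ℝ) * ((n : ℝ) - 1) ^ (k - 1)
        * (rescaledMatrix 0 (gradVec ρ p)
          (gradVec (fun x => (c 1 ∘ y) x * ρ x + (c 2 ∘ y) x * ρ x ^ 2) p) (hessMat ρ p)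
          (hessMat (fun x => (c 1 ∘ y) x * ρ x + (c 2 ∘ y) x * ρ x ^ 2) p)).trace
        - (n.choose k : ℝ) * ((n : ℝ) - 1) ^ k * (2 * k * c 1 p)
      = ((n - 1).choose (n - k) : ℝ) * ((n : ℝ) - 1) ^ (k - 1) * (2 * ((n : ℝ) - 1))
        * (meanCurvature Ω p - 2 * ((n : ℝ) - 1) * c 1 p) := by
    rw [trace_rescaledMatrix, gradVec_coefficient_terms hn h hp hc, trace_hessMat h,
      dotProduct_smul, gradVec_dotProduct_self h]
    have e1 := choose_mul_eq hk1 hk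
    have e2 : ((n : ℝ) - 1) ^ k = ((n : ℝ) - 1) ^ (k - 1) * ((n : ℝ) - 1) := by
      rw [← pow_succ]
      congr 1
      omega
    rw [e2]
    simp only [smul_eq_mul, mul_one, zero_mul, add_zero]
    linear_combination -2 * ((n : ℝ) - 1) ^ (k - 1) * ((n : ℝ) - 1) * c 1 p * e1
  rw [e] at hfin
  refine hfin.congr' ?_
  filter_upwards [eventually_opFtilde_eq hk hΩ h hw hr hu, h.eventually_eq] with x h1 h2
  rw [h1, h2.2.1]

end Expansion

section SecondOrder

variable {n k : ℕ} {Ω : Set (E n)} {p : E n} {y : E n → E n} {ρ : E n → ℝ}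
  {c : ℕ → E n → ℝ} {cn1 : E n → ℝ}

theorem hessMat_mulVec_gradVec (h : IsNormalCoordinates Ω p y ρ) :
    (hessMat ρ p).mulVec (gradVec ρ p) = 0 := by
  funext i
  exact (h.sum_hessian_mul_partialDeriv i).self_of_nhds

theorem trace_hessMat_mul_self (h : IsNormalCoordinates Ω p y ρ) :
    (hessMat ρ p * hessMat ρ p).trace = formNormSq (secondFundamentalForm Ω p) := by
  rw [h.formNormSq_eq, Matrix.trace]
  refine Finset.sum_congr rfl fun i _ => ?_
  rw [Matrix.diag_apply, Matrix.mul_apply]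
  refine Finset.sum_congr rfl fun j _ => ?_
  rw [(isSymm_hessMat_of_smooth h.smooth_dist).apply i j, pow_two]
  rfl

/-- The Riccati equation in the form in which it is used: if `c₁ = H / (2(n-1))` on the boundary,
then `Δρ + 2(n-1) C₁` vanishes there and its normal derivative is `-|Π|²`. -/
theorem tendsto_trace_hessMat_add_div (hn : 3 ≤ n) (hΩ : IsBoundedSmoothDomain Ω)
    (h : IsNormalCoordinates Ω p y ρ)
    (h1 : ∀ q ∈ frontier Ω, c 1 q = 1 / (2 * ((n : ℝ) - 1)) * meanCurvature Ω q) :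
    Tendsto (fun x => ((hessMat ρ x).trace + 2 * ((n : ℝ) - 1) * c 1 (y x)) / ρ x) (𝓝[Ω] p)
      (𝓝 (-formNormSq (secondFundamentalForm Ω p))) := by
  have hn1 : ((n : ℝ) - 1) ≠ 0 := by
    have : (3 : ℝ) ≤ n := by exact_mod_cast hn
    linarith
  have h2 := h.tendsto_sub_foot_div h.contDiffAt_lap
  rw [h.fderiv_lap_gradient, ← h.formNormSq_eq] at h2
  refine h2.congr' ?_
  filter_upwards [mem_nhdsWithin_of_mem_nhds h.foot_mem, mem_nhdsWithin_of_mem_nhds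
    (h.tendsto_foot.eventually (h.eventually_meanCurvature_eq hΩ))] with x h3 h4
  rw [h1 _ h3, h4 h3]
  have : (hessMat ρ x).trace = lap ρ x := rfl
  rw [this]
  field_simp
  ring

/-- The normal derivative of `w = C₁ ρ + C₂ ρ² + r` is `c₁ + 2 c₂ ρ + o(ρ)`, with `c₁` taken at the
foot point: the functions `Cᵢ` are constant along the normals. -/
theorem tendsto_gradVec_dotProduct_sub_div (hn : 3 ≤ n) (h : IsNormalCoordinates Ω p y ρ)
    (hp : p ∈ frontier Ω) (hc : SmoothCoefficients Ω c cn1) {r : E n → ℝ}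
    (hr : IsRemainder (𝓝[Ω] p) ρ r) :
    Tendsto (fun x => (gradVec ρ x ⬝ᵥ
      gradVec (fun x => ((c 1 ∘ y) x * ρ x + (c 2 ∘ y) x * ρ x ^ 2) + r x) x - c 1 (y x)) / ρ x)
      (𝓝[Ω] p) (𝓝 (2 * c 2 p)) := by
  have hs : ∀ i < n, ContDiffAt ℝ ∞ (c i ∘ y) p := fun i hi => h.contDiffAt_comp_foot hp (hc.1 i hi)
  have dot : ∀ {v w : E n → Fin n → ℝ} {v₀ w₀ : Fin n → ℝ}, Tendsto v (𝓝[Ω] p) (𝓝 v₀) →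
      Tendsto w (𝓝[Ω] p) (𝓝 w₀) → Tendsto (fun x => v x ⬝ᵥ w x) (𝓝[Ω] p) (𝓝 (v₀ ⬝ᵥ w₀)) :=
    fun {v w v₀ w₀} hv hw =>
      ((continuous_fst.dotProduct continuous_snd).tendsto (v₀, w₀)).comp (hv.prodMk_nhds hw)
  have t1 := dot (tendsto_gradVec (Ω := Ω) (hs 1 (by omega))) (tendsto_gradVec h.smooth_dist)
  have t2 := dot (tendsto_gradVec (Ω := Ω) (hs 2 (by omega))) (tendsto_gradVec h.smooth_dist)
  have t3 : Tendsto (c 2 ∘ y) (𝓝[Ω] p) (𝓝 (c 2 p)) := by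
    have := (hs 2 (by omega)).continuousAt.tendsto
    rw [Function.comp_apply, h.foot_self] at this
    exact this.mono_left nhdsWithin_le_nhds
  have t4 : Tendsto (fun x => gradVec ρ x ⬝ᵥ fun i => partialDeriv i r x / ρ x) (𝓝[Ω] p)
      (𝓝 (gradVec ρ p ⬝ᵥ 0)) :=
    dot (tendsto_gradVec h.smooth_dist) (tendsto_pi_nhds.mpr hr.tendsto_partialDeriv_div)
  have e1 : gradVec (c 1 ∘ y) p ⬝ᵥ gradVec ρ p = 0 :=
    h.sum_partialDeriv_comp_foot hp (hc.1 1 (by omega))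
  have t5 := ((t1.add (t2.mul (h.tendsto_dist.mono_right nhdsWithin_le_nhds))).add
    (t3.const_mul 2)).add t4
  rw [e1, dotProduct_zero, mul_zero, add_zero, zero_add, zero_add] at t5
  refine t5.congr' ?_
  filter_upwards [eventually_gradVec_add (contDiffAt_coefficient_terms hn h hp hc) hr,
    eventually_smooth_within (Ω := Ω) (hs 1 (by omega)),
    eventually_smooth_within (Ω := Ω) (hs 2 (by omega)), eventually_smooth_within h.smooth_dist,
    h.eventually_eq, mem_nhdsWithin_of_mem_nhds h.sum_partialDeriv_sq] with x h1 h2 h3 h4 h5 h6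
  have e2 : gradVec ρ x ⬝ᵥ gradVec (fun x => (c 1 ∘ y) x * ρ x + (c 2 ∘ y) x * ρ x ^ 2) x
      = ρ x * (gradVec (c 1 ∘ y) x ⬝ᵥ gradVec ρ x) + c 1 (y x)
        + ρ x ^ 2 * (gradVec (c 2 ∘ y) x ⬝ᵥ gradVec ρ x) + 2 * c 2 (y x) * ρ x := by
    have key : ∀ i, gradVec ρ x i
        * gradVec (fun x => (c 1 ∘ y) x * ρ x + (c 2 ∘ y) x * ρ x ^ 2) x i
        = ρ x * (partialDeriv i (c 1 ∘ y) x * partialDeriv i ρ x)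
          + c 1 (y x) * partialDeriv i ρ x ^ 2
          + ρ x ^ 2 * (partialDeriv i (c 2 ∘ y) x * partialDeriv i ρ x)
          + 2 * c 2 (y x) * ρ x * partialDeriv i ρ x ^ 2 := by
      intro i
      simp only [gradVec]
      rw [partialDeriv_coefficient_terms (h2.differentiableAt (by simp))
        (h3.differentiableAt (by simp)) (h4.differentiableAt (by simp))]
      simp only [Function.comp_apply]
      ring
    simp only [dotProduct, key, Finset.sum_add_distrib, ← Finset.mul_sum, h6]
    simp only [gradVec]
    ring
  have h0 := h5.1.ne'
  have e3 : (gradVec ρ x ⬝ᵥ fun i => partialDeriv i r x / ρ x)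
      = (gradVec ρ x ⬝ᵥ gradVec r x) / ρ x := by
    simp only [dotProduct, Finset.sum_div, mul_div_assoc]
    rfl
  rw [h1, dotProduct_add, e2, e3]
  simp only [Function.comp_apply]
  field_simp
  ring

/-- The second coefficient of `F̃(v)` when `c₀ = 0` and `c₁ = H / (2(n-1))`. -/
theorem tendsto_opFtilde_div_sq (hn : 3 ≤ n) (hk1 : 1 ≤ k) (hk : k ≤ n)
    (hΩ : IsBoundedSmoothDomain Ω)
    (h : IsNormalCoordinates Ω p y ρ) (hp : p ∈ frontier Ω) (hc : SmoothCoefficients Ω c cn1)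
    (h0 : ∀ q ∈ frontier Ω, c 0 q = 0)
    (h1 : ∀ q ∈ frontier Ω, c 1 q = 1 / (2 * ((n : ℝ) - 1)) * meanCurvature Ω q) :
    Tendsto (fun x => opFtilde Ω k (ansatz Ω c cn1) x / bdist Ω x ^ 2) (𝓝[Ω] p)
      (𝓝 (((n - 1).choose (n - k) : ℝ) * ((n : ℝ) - 1) ^ (k - 1)
        * (6 * ((n : ℝ) - 1) * ((n : ℝ) - 2)) * (c2Formula Ω k p - c 2 p))) := by
  have hn3 : (3 : ℝ) ≤ n := by exact_mod_cast hn
  have hn1 : ((n : ℝ) - 1) ≠ 0 := by linarith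
  have hn2 : ((n : ℝ) - 2) ≠ 0 := by linarith
  have hn0 : (n : ℝ) ≠ 0 := by linarith
  obtain ⟨r, hr, hu⟩ := exists_ansatz_eq_of_zero hn h hp hc h0
  have hw := contDiffAt_coefficient_terms hn h hp hc
  set w : E n → ℝ := fun x => (c 1 ∘ y) x * ρ x + (c 2 ∘ y) x * ρ x ^ 2 with hwdef
  have hd0 : ∀ᶠ x in 𝓝[Ω] p, ρ x ≠ 0 := h.eventually_eq.mono fun x hx => hx.1.ne'
  have hρ0 : Tendsto ρ (𝓝[Ω] p) (𝓝 0) := h.tendsto_dist.mono_right nhdsWithin_le_nhds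
  have hC : ∀ i < n, Tendsto (c i ∘ y) (𝓝[Ω] p) (𝓝 (c i p)) := fun i hi => by
    have := (h.contDiffAt_comp_foot hp (hc.1 i hi)).continuousAt.tendsto
    rw [Function.comp_apply, h.foot_self] at this
    exact this.mono_left nhdsWithin_le_nhds
  have hlim : Tendsto (fun x => (w x + r x - (c 1 ∘ y) x * ρ x) / ρ x ^ 2) (𝓝[Ω] p)
      (𝓝 (c 2 p)) := by
    have := (hC 2 (by omega)).add hr.tendsto_div_sq
    rw [add_zero] at this
    refine this.congr' ?_
    filter_upwards [hd0] with x hx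
    simp only [hwdef]
    field_simp
    ring
  have e1 := choose_mul_eq hk1 hk
  have e2 : ((n : ℝ) - 1) ^ k = ((n : ℝ) - 1) ^ (k - 1) * ((n : ℝ) - 1) := by
    rw [← pow_succ]
    congr 1
    omega
  set A := ((n - 1).choose (n - k) : ℝ) * ((n : ℝ) - 1) ^ (k - 1) with hA
  have e3 : (n.choose k : ℝ) * ((n : ℝ) - 1) ^ k * k = n * (A * ((n : ℝ) - 1)) := by
    rw [e2, hA]
    linear_combination ((n : ℝ) - 1) ^ (k - 1) * ((n : ℝ) - 1) * e1
  have hgw := gradVec_coefficient_terms hn h hp hc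
  have hnorm := gradVec_dotProduct_self h
  have tT : Tendsto (fun x => (hessMat (fun z => w z + r z) x).trace) (𝓝[Ω] p)
      (𝓝 (c 1 p * -meanCurvature Ω p + 2 * c 2 p)) := by
    have hl := trace_hessMat_coefficient_terms
      ((h.contDiffAt_comp_foot hp (hc.1 1 (by omega))).of_le (natCast_le_infty 2))
      ((h.contDiffAt_comp_foot hp (hc.1 2 (by omega))).of_le (natCast_le_infty 2))
      h.smooth_two h.dist_self h.sum_partialDeriv_sq.self_of_nhds
      (h.sum_partialDeriv_comp_foot hp (hc.1 1 (by omega)))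
    rw [trace_hessMat h, Function.comp_apply, Function.comp_apply, h.foot_self] at hl
    rw [← hl]
    exact ((continuous_id.matrix_trace).tendsto _).comp (tendsto_hessMat_add hw hr)
  have tb : Tendsto (fun x => gradVec (fun z => w z + r z) x ⬝ᵥ gradVec (fun z => w z + r z) x)
      (𝓝[Ω] p) (𝓝 (c 1 p ^ 2)) := by
    have hg := tendsto_gradVec_add h hw hr
    have := ((continuous_fst.dotProduct continuous_snd).tendsto
      (gradVec w p, gradVec w p)).comp (hg.prodMk_nhds hg)
    rw [hgw] at this
    simp only [smul_dotProduct, dotProduct_smul, hnorm, smul_eq_mul, mul_one, ← pow_two] at this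
    exact this
  have tτ : Tendsto (fun x => (A * (rescaledMatrixAt ρ (fun z => w z + r z) x).trace
      - (n.choose k : ℝ) * ((n : ℝ) - 1) ^ k * (2 * k * (c 1 ∘ y) x)) / ρ x) (𝓝[Ω] p)
      (𝓝 (A * ((n : ℝ) - 1) * (-2 * -formNormSq (secondFundamentalForm Ω p)
        - 2 * ((n : ℝ) - 2) * (2 * c 2 p) + (2 * (c 1 p * -meanCurvature Ω p + 2 * c 2 p)
          + ((n : ℝ) - 2) * c 1 p ^ 2)))) := by
    have tg : Tendsto (fun x => (gradVec ρ x ⬝ᵥ gradVec (fun z => w z + r z) x - c 1 (y x)) / ρ x)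
        (𝓝[Ω] p) (𝓝 (2 * c 2 p)) := tendsto_gradVec_dotProduct_sub_div hn h hp hc hr
    refine Tendsto.congr' ?_ ((((((tendsto_trace_hessMat_add_div hn hΩ h h1).const_mul (-2))).sub
      (tg.const_mul (2 * ((n : ℝ) - 2)))).add
      ((tT.const_mul 2).add (tb.const_mul ((n : ℝ) - 2)))).const_mul (A * ((n : ℝ) - 1)))
    filter_upwards [hd0] with x hx
    rw [rescaledMatrixAt, trace_rescaledMatrix, Function.comp_apply]
    have e4 : (n.choose k : ℝ) * ((n : ℝ) - 1) ^ k * (2 * k * c 1 (y x))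
        = 2 * c 1 (y x) * (n * (A * ((n : ℝ) - 1))) := by
      linear_combination 2 * c 1 (y x) * e3
    rw [e4]
    field_simp
    ring
  have hfin := tendsto_sigma_sub_exp_div_sq (m := (n : ℝ) - 1) (by omega) hk
    hρ0 hd0 (tendsto_rescaledMatrixAt h hw hr)
    (eventually_isSymm_rescaledMatrixAt h hw hr)
    (isSymm_rescaledMatrix _ _ _ (isSymm_hessMat_of_smooth h.smooth_dist)
      (isSymm_hessMat_of_smooth hw)) (hC 1 (by omega)) hlim tτ
  rw [trace_rescaledMatrix, hgw, trace_rescaledMatrix_mul_self _ _ _ _ hnorm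
    (hessMat_mulVec_gradVec h), trace_hessMat h, trace_hessMat_mul_self h, dotProduct_smul, hnorm,
    h1 p hp] at hfin
  have hA2 : ((n - 2).choose (n - k) : ℝ) * ((n : ℝ) - 1) ^ (k - 2)
      = ((k : ℝ) - 1) * A / ((n : ℝ) - 1) ^ 2 := by
    rw [eq_div_iff (pow_ne_zero 2 hn1)]
    exact choose_mul_pow_eq (by omega) hk1 hk
  have hK : ∀ a b : ℝ, (n.choose k : ℝ) * ((n : ℝ) - 1) ^ k * (2 * k * a + 2 * k ^ 2 * b)
      = n * (A * ((n : ℝ) - 1)) * (2 * a + 2 * k * b) := fun a b => by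
    linear_combination (2 * a + 2 * k * b) * e3
  rw [hA2, hK] at hfin
  rw [c2Formula, h.formNormSq_traceFree_eq (by omega)]
  refine (hfin.congr' ?_).trans (le_of_eq ?_)
  · filter_upwards [eventually_opFtilde_eq hk hΩ.isOpen h hw hr hu, h.eventually_eq] with x h3 h4
    rw [h3, h4.2.1]
  · -- both sides are polynomials in `H`, `|Π|²`, `c₂` and `k` with the common factor `A`
    congr 1
    simp only [smul_eq_mul, mul_one, zero_mul, add_zero]
    field_simp
    ring

end SecondOrder

/-! ### From the boundary points to the boundary -/

section Global

variable {n : ℕ} {Ω : Set (E n)}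

/-- A bounded domain has a boundary, since `ℝⁿ` is connected and noncompact. In particular
`bdist` is not the distance to the empty set, which is `0` by convention. -/
theorem frontier_nonempty (hn : 1 ≤ n) (hΩ : IsBoundedSmoothDomain Ω) : (frontier Ω).Nonempty := by
  rw [Set.nonempty_iff_ne_empty]
  intro h
  have : Nonempty (Fin n) := ⟨⟨0, hn⟩⟩
  have hu : Ω = Set.univ := (isClopen_iff_frontier_eq_empty.mpr h).eq_univ hΩ.isConnected.nonempty
  have hb := hΩ.isBounded
  rw [hu] at hb
  have hc : IsCompact (Set.univ : Set (E n)) :=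
    Metric.isCompact_of_isClosed_isBounded isClosed_univ hb
  have : NoncompactSpace (E n) := NormedSpace.noncompactSpace ℝ (E n)
  exact noncompact_univ (E n) hc

theorem nhdsWithin_le_nearBoundary {p : E n} (hp : p ∈ frontier Ω) :
    𝓝[Ω] p ≤ nearBoundary Ω :=
  le_inf ((tendsto_iff_comap.mp (tendsto_bdist_nhds hp)).trans' nhdsWithin_le_nhds) inf_le_right

/-- By compactness of the boundary, what holds near each boundary point holds uniformly near the
boundary. -/
theorem eventually_nearBoundary (hn : 1 ≤ n) (hΩ : IsBoundedSmoothDomain Ω) {P : E n → Prop}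
    (h : ∀ p ∈ frontier Ω, ∀ᶠ x in 𝓝[Ω] p, P x) : ∀ᶠ x in nearBoundary Ω, P x := by
  have h1 : {x | x ∈ Ω → P x} ∈ 𝓝ˢ (frontier Ω) := by
    rw [mem_nhdsSet_iff_forall]
    exact fun p hp => eventually_nhdsWithin_iff.mp (h p hp)
  obtain ⟨ε, hε, hsub⟩ := (Metric.hasBasis_nhdsSet_thickening hΩ.isCompact_frontier).mem_iff.mp h1
  have h2 : ∀ᶠ x in comap (bdist Ω) (𝓝 0), bdist Ω x < ε :=
    tendsto_comap.eventually_lt_const hε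
  rw [nearBoundary, eventually_inf_principal]
  filter_upwards [h2] with x hx
  exact hsub ((Metric.mem_thickening_iff_infDist_lt (frontier_nonempty hn hΩ)).mpr hx)

/-- A function is `o(d²)` uniformly near the boundary if and only if it is so at each boundary
point. -/
theorem isLittleO_nearBoundary_iff (hn : 1 ≤ n) (hΩ : IsBoundedSmoothDomain Ω) {f : E n → ℝ} :
    Asymptotics.IsLittleO (nearBoundary Ω) f (fun x => bdist Ω x ^ 2)
      ↔ ∀ p ∈ frontier Ω, Tendsto (fun x => f x / bdist Ω x ^ 2) (𝓝[Ω] p) (𝓝 0) := by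
  constructor
  · intro h p hp
    exact (h.mono (nhdsWithin_le_nearBoundary hp)).tendsto_div_nhds_zero
  · intro h
    rw [Asymptotics.isLittleO_iff]
    intro a ha
    refine eventually_nearBoundary hn hΩ fun p hp => ?_
    obtain ⟨y, ρ, hN⟩ := exists_isNormalCoordinates hΩ hp
    have h1 : Asymptotics.IsLittleO (𝓝[Ω] p) f (fun x => bdist Ω x ^ 2) := by
      refine (Asymptotics.isLittleO_iff_tendsto' ?_).mpr (h p hp)
      filter_upwards [hN.eventually_eq] with x hx hx0
      rw [hx.2.1] at hx0
      exact absurd hx0 (pow_ne_zero 2 hx.1.ne')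
    exact h1.def ha

theorem isLittleO_bdist_rpow {s : ℝ} (hs : 2 < s) :
    Asymptotics.IsLittleO (nearBoundary Ω) (fun x => bdist Ω x ^ s)
      (fun x => bdist Ω x ^ 2) := by
  have h0 : ∀ x, bdist Ω x = 0 → bdist Ω x ^ s = 0 := fun x hx => by
    rw [hx, Real.zero_rpow (by linarith)]
  refine (Asymptotics.isLittleO_iff_tendsto' (Eventually.of_forall fun x hx =>
    h0 x (pow_eq_zero_iff (two_ne_zero) |>.mp hx))).mpr ?_
  have ht : Tendsto (bdist Ω) (nearBoundary Ω) (𝓝 0) := tendsto_comap.mono_left inf_le_left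
  have h1 : Tendsto (fun x => bdist Ω x ^ (s - 2)) (nearBoundary Ω) (𝓝 ((0 : ℝ) ^ (s - 2))) :=
    ht.rpow_const (Or.inr (by linarith))
  rw [Real.zero_rpow (by linarith)] at h1
  refine h1.congr fun x => ?_
  have hx0 : 0 ≤ bdist Ω x := Metric.infDist_nonneg
  rcases hx0.eq_or_lt with hx | hx
  · rw [h0 x hx.symm, ← hx, Real.zero_rpow (by linarith), zero_div]
  · rw [Real.rpow_sub hx, Real.rpow_two]

variable {k : ℕ} {c : ℕ → E n → ℝ} {cn1 : E n → ℝ}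

theorem coefficients_of_isLittleO (hn : 3 ≤ n) (hk : 1 ≤ k) (hkn : k ≤ n)
    (hΩ : IsBoundedSmoothDomain Ω) (hc : SmoothCoefficients Ω c cn1)
    (h : Asymptotics.IsLittleO (nearBoundary Ω) (opFtilde Ω k (ansatz Ω c cn1))
      (fun x => bdist Ω x ^ 2)) :
    ∀ q ∈ frontier Ω, c 0 q = 0 ∧ c 1 q = 1 / (2 * ((n : ℝ) - 1)) * meanCurvature Ω q ∧
      c 2 q = c2Formula Ω k q := by
  rw [isLittleO_nearBoundary_iff (by omega) hΩ] at h
  have hn3 : (3 : ℝ) ≤ n := by exact_mod_cast hn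
  have hn1 : ((n : ℝ) - 1) ≠ 0 := by linarith
  have hn2 : ((n : ℝ) - 2) ≠ 0 := by linarith
  have hk0 : (k : ℝ) ≠ 0 := by exact_mod_cast (by omega : k ≠ 0)
  have hb0 : ∀ p ∈ frontier Ω, ∀ᶠ x in 𝓝[Ω] p, bdist Ω x ≠ 0 := fun p hp => by
    obtain ⟨y, ρ, hN⟩ := exists_isNormalCoordinates hΩ hp
    filter_upwards [hN.eventually_eq] with x hx
    rw [hx.2.1]
    exact hx.1.ne'
  have hbt : ∀ p ∈ frontier Ω, Tendsto (bdist Ω) (𝓝[Ω] p) (𝓝 0) := fun p hp =>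
    (tendsto_bdist_nhds hp).mono_left nhdsWithin_le_nhds
  have hne : ∀ p ∈ frontier Ω, (𝓝[Ω] p).NeBot := fun p hp =>
    mem_closure_iff_nhdsWithin_neBot.mp hp.1
  have hchoose : ((n - 1).choose (n - k) : ℝ) ≠ 0 := by
    exact_mod_cast (Nat.choose_pos (by omega)).ne'
  have h0 : ∀ q ∈ frontier Ω, c 0 q = 0 := by
    intro p hp
    obtain ⟨y, ρ, hN⟩ := exists_isNormalCoordinates hΩ hp
    have t1 : Tendsto (opFtilde Ω k (ansatz Ω c cn1)) (𝓝[Ω] p) (𝓝 0) := by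
      have := (h p hp).mul ((hbt p hp).pow 2)
      rw [zero_mul] at this
      refine this.congr' ?_
      filter_upwards [hb0 p hp] with x hx
      field_simp
    have := hne p hp
    have e := tendsto_nhds_unique t1 (tendsto_opFtilde hn hkn hΩ.isOpen hN hp hc)
    have hnk : (n.choose k : ℝ) ≠ 0 := by exact_mod_cast (Nat.choose_pos hkn).ne'
    have e1 := (mul_eq_zero.mp e.symm).resolve_left (mul_ne_zero hnk (pow_ne_zero k hn1))
    have e2 : Real.exp (2 * (k : ℝ) * c 0 p) = 1 := by linarith
    have e3 := Real.exp_eq_one_iff _ |>.mp e2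
    simpa [hk0] using e3
  have h1 : ∀ q ∈ frontier Ω, c 1 q = 1 / (2 * ((n : ℝ) - 1)) * meanCurvature Ω q := by
    intro p hp
    obtain ⟨y, ρ, hN⟩ := exists_isNormalCoordinates hΩ hp
    have t1 : Tendsto (fun x => opFtilde Ω k (ansatz Ω c cn1) x / bdist Ω x) (𝓝[Ω] p) (𝓝 0) := by
      have := (h p hp).mul (hbt p hp)
      rw [zero_mul] at this
      refine this.congr' ?_
      filter_upwards [hb0 p hp] with x hx
      field_simp
    have := hne p hp
    have e := tendsto_nhds_unique t1 (tendsto_opFtilde_div hn hk hkn hΩ.isOpen hN hp hc h0)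
    have e1 := (mul_eq_zero.mp e.symm).resolve_left
      (mul_ne_zero (mul_ne_zero hchoose (pow_ne_zero _ hn1)) (mul_ne_zero two_ne_zero hn1))
    field_simp
    linarith
  refine fun p hp => ⟨h0 p hp, h1 p hp, ?_⟩
  obtain ⟨y, ρ, hN⟩ := exists_isNormalCoordinates hΩ hp
  have := hne p hp
  have e := tendsto_nhds_unique (h p hp) (tendsto_opFtilde_div_sq hn hk hkn hΩ hN hp hc h0 h1)
  have e1 := (mul_eq_zero.mp e.symm).resolve_left
    (mul_ne_zero (mul_ne_zero hchoose (pow_ne_zero _ hn1))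
      (mul_ne_zero (mul_ne_zero (by norm_num) hn1) hn2))
  linarith

theorem isLittleO_of_coefficients (hn : 3 ≤ n) (hk : 1 ≤ k) (hkn : k ≤ n)
    (hΩ : IsBoundedSmoothDomain Ω) (hc : SmoothCoefficients Ω c cn1)
    (h : ∀ q ∈ frontier Ω, c 0 q = 0 ∧ c 1 q = 1 / (2 * ((n : ℝ) - 1)) * meanCurvature Ω q ∧
      c 2 q = c2Formula Ω k q) :
    Asymptotics.IsLittleO (nearBoundary Ω) (opFtilde Ω k (ansatz Ω c cn1))
      (fun x => bdist Ω x ^ 2) := by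
  refine (isLittleO_nearBoundary_iff (by omega) hΩ).mpr fun p hp => ?_
  obtain ⟨y, ρ, hN⟩ := exists_isNormalCoordinates hΩ hp
  have h1 := tendsto_opFtilde_div_sq hn hk hkn hΩ hN hp hc (fun q hq => (h q hq).1)
    (fun q hq => (h q hq).2.1)
  rwa [(h p hp).2.2, sub_self, mul_zero] at h1

end Global

end SigmaKRicci

theorem proposition2p2 (n k : ℕ) (hn : 3 ≤ n) (hk : 1 ≤ k) (hkn : k ≤ n)
    (Ω : Set (SigmaKRicci.E n)) (hΩ : SigmaKRicci.IsBoundedSmoothDomain Ω)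
    (c : ℕ → SigmaKRicci.E n → ℝ) (cn1 : SigmaKRicci.E n → ℝ)
    (hc : SigmaKRicci.SmoothCoefficients Ω c cn1) :
    -- The coefficients of `1`, `d`, `d²` in `F̃(v)` vanish exactly when `c₀ = 0`, `c₁` is
    -- `H / (2 (n - 1))` and `c₂` is given by the formula.
    (Asymptotics.IsLittleO (SigmaKRicci.nearBoundary Ω)
        (SigmaKRicci.opFtilde Ω k (SigmaKRicci.ansatz Ω c cn1))
        (fun x => SigmaKRicci.bdist Ω x ^ 2) ↔
      ∀ y ∈ frontier Ω,
        c 0 y = 0 ∧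
        c 1 y = 1 / (2 * ((n : ℝ) - 1)) * SigmaKRicci.meanCurvature Ω y ∧
        c 2 y = SigmaKRicci.c2Formula Ω k y) ∧
    -- In particular, the formula holds for `c₂` whenever `v` is a formal solution,
    -- `F̃(v) = O(d^{n+τ})`.
    (∀ τ : ℝ, 0 < τ → τ < 1 →
      Asymptotics.IsBigO (SigmaKRicci.nearBoundary Ω)
        (SigmaKRicci.opFtilde Ω k (SigmaKRicci.ansatz Ω c cn1))
        (fun x => SigmaKRicci.bdist Ω x ^ ((n : ℝ) + τ)) →
      ∀ y ∈ frontier Ω, c 2 y = SigmaKRicci.c2Formula Ω k y) := by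
  refine ⟨⟨SigmaKRicci.coefficients_of_isLittleO hn hk hkn hΩ hc,
    SigmaKRicci.isLittleO_of_coefficients hn hk hkn hΩ hc⟩, fun τ hτ _ hO y hy => ?_⟩
  have hn3 : (3 : ℝ) ≤ n := by exact_mod_cast hn
  have ho := hO.trans_isLittleO (SigmaKRicci.isLittleO_bdist_rpow (s := (n : ℝ) + τ) (by linarith))
  exact (SigmaKRicci.coefficients_of_isLittleO hn hk hkn hΩ hc ho y hy).2.2
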